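/- Let $\rho\ge 0$ be a probability density on $[0,1]$, continuous on $(0,1)$, with first moment $c_1=\int_0^1 t\rho(t)\,dt$ and Stieltjes transform $S_\rho(z)=\int_0^1\frac{\rho(t)}{z-t}\,dt$ for $z\in\mathbb C\setminus[0,1]$. Assume that $\rho$ has a secondary measure with a density $\mu$, that is, an integrable function $\mu\ge 0$ on $[0,1]$ with $$S_\mu(z)=z-c_1-\frac1{S_\rho(z)}\qquad(z\in\mathbb C\setminus[0,1]).$$ For a density $\sigma\in\{\rho,\mu\}$, its reducer at $x$ is $\lim_{\varepsilon\to0^+}2\int_0^1\frac{(x-t)\,\sigma(t)}{(x-t)^2+\varepsilon^2}\,dt=\lim_{\varepsilon\to0^+}\big(S_\sigma(x-i\varepsilon)+S_\sigma(x+i\varepsilon)\big)$ when this limit exists; write $\varphi$ for the reducer of $\rho$ and $\psi$ for that of $\mu$. Let $$T_\sigma(f)(x)=\int_0^1\frac{f(t)-f(x)}{t-x}\,\sigma(t)\,dt ,$$ the integral being taken as a principal value at $t=x$ (so it is the Lebesgue integral whenever it converges absolutely). On polynomials, $T_\rho$ extends by continuity to a map $L^2(\rho)\to L^2(\mu)$;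 let $H_\rho=\{f\in L^2(\rho):\int f\rho=0\}$. Then there is a Lebesgue-null set $N$, containing no point of $(0,1)$ at which $\mu$ is continuous, such that: 1. For every $x\in(0,1)\setminus N$ with $\rho(x)\ne0$ at which $\varphi(x)$ exists, $\psi(x)$ exists and $$\psi(x)=2(x-c_1)-\frac{\varphi(x)\mu(x)}{\rho(x)}.$$ 2. Suppose moreover that $\rho$ is Lipschitz on $[0,1]$, and let $g$ be continuous on $[0,1]$. Then $\varphi(x)$ exists for all $x\in(0,1)$, and: (a) For every $x\in(0,1)\setminus N$ with $\rho(x)\neq0$ for which $T_\mu(g)(x)$ converges, $T_\rho\big(\frac{\mu}{\rho}g\big)(x)$ converges too (absolutely, if $T_\mu(g)(x)$ does), and $$\varphi(x)\frac{\mu(x)}{\rho(x)}g(x)-T_\rho\Big(\frac{\mu}{\rho}g\Big)(x)=(x-c_1)g(x)-T_\mu(g)(x).$$ (b) If $T_\mu(g)(x)$ converges for $\rho$-almost every $x$, then $f(x)=(x-c_1)g(x)-T_\mu(g)(x)$ is the solution in $H_\rho$ of the integral equation $\int_0^1\frac{f(t)-f(x)}{t-x}\rho(t)\,dt=g(x)$: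 one has $f\in H_\rho$; $T_\rho(f)=g$ for the extended operator; the integral equation holds (as a principal value) for $\rho$-almost every $x$; and any $f_1\in H_\rho$ with $T_\rho(f_1)=g$ for the extended operator equals $f$ $\rho$-almost everywhere. -/

import Mathlib

open MeasureTheory Set Filter Topology

noncomputable section

namespace SecondaryMeasure

/-- The first moment `c₁ = ∫₀¹ t ρ(t) dt`. -/
def firstMoment (ρ : ℝ → ℝ) : ℝ := ∫ t in Icc (0 : ℝ) 1, t * ρ t

/-- The Stieltjes transform `S_ρ(z) = ∫₀¹ ρ(t) / (z - t) dt`, used for `z ∉ [0, 1]`. -/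
def stieltjes (ρ : ℝ → ℝ) (z : ℂ) : ℂ := ∫ t in Icc (0 : ℝ) 1, (ρ t : ℂ) / (z - (t : ℂ))

/-- A probability density on `[0, 1]`, continuous on the open interval. -/
structure IsProbDensity (ρ : ℝ → ℝ) : Prop where
  nonneg : ∀ x ∈ Ioo (0 : ℝ) 1, 0 ≤ ρ x
  integrable : IntegrableOn ρ (Icc 0 1)
  total_mass : ∫ t in Icc (0 : ℝ) 1, ρ t = 1
  continuousOn : ContinuousOn ρ (Ioo 0 1)

/-- `μ` is a density of the secondary measure of `ρ`: a nonnegative integrable function on `[0, 1]`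
whose Stieltjes transform is coupled to that of `ρ` by `S_μ(z) = z - c₁ - 1 / S_ρ(z)`. -/
structure IsSecondaryDensity (ρ μ : ℝ → ℝ) : Prop where
  nonneg : ∀ x ∈ Ioo (0 : ℝ) 1, 0 ≤ μ x
  integrable : IntegrableOn μ (Icc 0 1)
  coupling : ∀ z : ℂ, z ∉ (fun t : ℝ => (t : ℂ)) '' Icc (0 : ℝ) 1 →
    stieltjes μ z = z - (firstMoment ρ : ℂ) - 1 / stieltjes ρ z

/-- The reducer of `ρ` exists at `x`, with value `v`:
`2 ∫₀¹ (x - t) ρ(t) / ((x - t)² + ε²) dt → v` as `ε → 0⁺`. The expression under the limit is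
`S_ρ(x - iε) + S_ρ(x + iε)`. -/
def HasReducerAt (ρ : ℝ → ℝ) (x v : ℝ) : Prop :=
  Tendsto (fun ε : ℝ => 2 * ∫ t in Icc (0 : ℝ) 1, (x - t) * ρ t / ((x - t) ^ 2 + ε ^ 2))
    (𝓝[>] 0) (𝓝 v)

/-- The reducer of `ρ` (meaningful at the points where the limit exists). -/
def reducer (ρ : ℝ → ℝ) (x : ℝ) : ℝ :=
  limUnder (𝓝[>] (0 : ℝ))
    (fun ε : ℝ => 2 * ∫ t in Icc (0 : ℝ) 1, (x - t) * ρ t / ((x - t) ^ 2 + ε ^ 2))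

/-- The integrand of `T_ρ(f)(x) = ∫₀¹ (f(t) - f(x)) / (t - x) ρ(t) dt`. -/
def secKernel (ρ f : ℝ → ℝ) (x t : ℝ) : ℝ := (f t - f x) / (t - x) * ρ t

/-- The integral defining `T_ρ(f)(x)`, restricted to `|t - x| > ε`. -/
def truncSecOp (ρ f : ℝ → ℝ) (x ε : ℝ) : ℝ :=
  ∫ t in Icc (0 : ℝ) 1 ∩ {t | ε < |t - x|}, secKernel ρ f x t

/-- The integral `∫₀¹ (f(t) - f(x)) / (t - x) ρ(t) dt` converges, at least as a principal value at
the point `t = x`. Absolute convergence is a special case, see `secOp_eq_integral`. -/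
def SecOpConverges (ρ f : ℝ → ℝ) (x : ℝ) : Prop :=
  ∃ v : ℝ, Tendsto (truncSecOp ρ f x) (𝓝[>] 0) (𝓝 v)

/-- `T_ρ(f)(x) = ∫₀¹ (f(t) - f(x)) / (t - x) ρ(t) dt`. -/
def secOp (ρ f : ℝ → ℝ) (x : ℝ) : ℝ := limUnder (𝓝[>] (0 : ℝ)) (truncSecOp ρ f x)

/-- When the integral converges absolutely, `T_ρ(f)(x)` is the ordinary Lebesgue integral. -/
theorem secOp_eq_integral {ρ f : ℝ → ℝ} {x : ℝ} (h : IntegrableOn (secKernel ρ f x) (Icc 0 1)) :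
    SecOpConverges ρ f x ∧ secOp ρ f x = ∫ t in Icc (0 : ℝ) 1, (f t - f x) / (t - x) * ρ t := by
  have hm : ∀ ε : ℝ, MeasurableSet {t : ℝ | ε < |t - x|} := fun ε =>
    measurableSet_lt measurable_const (by fun_prop)
  have key : Tendsto (truncSecOp ρ f x) (𝓝[>] 0)
      (𝓝 (∫ t in Icc (0 : ℝ) 1, secKernel ρ f x t)) := by
    have e : truncSecOp ρ f x = fun ε => ∫ t in Icc (0 : ℝ) 1,
        {t : ℝ | ε < |t - x|}.indicator (secKernel ρ f x) t := by
      funext ε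
      rw [truncSecOp, setIntegral_indicator (hm ε)]
    rw [e]
    refine tendsto_integral_filter_of_dominated_convergence (fun t => ‖secKernel ρ f x t‖)
      (Eventually.of_forall fun ε => h.aestronglyMeasurable.indicator (hm ε))
      (Eventually.of_forall fun ε => Eventually.of_forall fun t => norm_indicator_le_norm_self _ _)
      h.norm ?_
    have hx : ∀ᵐ t ∂(volume.restrict (Icc (0 : ℝ) 1)), t ≠ x :=
      ae_restrict_of_ae (Measure.ae_ne volume x)
    filter_upwards [hx] with t ht
    have hpos : 0 < |t - x| := abs_pos.mpr (sub_ne_zero.mpr ht)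
    refine tendsto_const_nhds.congr' ?_
    filter_upwards [mem_nhdsWithin_of_mem_nhds (Iio_mem_nhds hpos)] with ε hε
    rw [indicator_of_mem]
    exact hε
  exact ⟨⟨_, key⟩, key.limUnder_eq⟩

/-- The measure `ρ(t) dt` on `[0, 1]`. -/
def densMeasure (ρ : ℝ → ℝ) : Measure ℝ :=
  (volume.restrict (Icc (0 : ℝ) 1)).withDensity (fun t => ENNReal.ofReal (ρ t))

/-- `f` belongs to `H_ρ`, the hyperplane of `L²([0, 1], ρ)` orthogonal to the constant `1`. -/
def MemHyperplane (ρ f : ℝ → ℝ) : Prop :=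
  MemLp f 2 (densMeasure ρ) ∧ ∫ t, f t ∂(densMeasure ρ) = 0

/-- `T_ρ(f) = g` for the extension of `T_ρ` by continuity from the polynomials to a map
`L²([0, 1], ρ) → L²([0, 1], μ)`: there are polynomials `p k` with `p k → f` in `L²(ρ)` and
`T_ρ(p k) → g` in `L²(μ)`. -/
def HasL2Image (ρ μ f g : ℝ → ℝ) : Prop :=
  MemLp f 2 (densMeasure ρ) ∧ MemLp g 2 (densMeasure μ) ∧
  ∃ p : ℕ → Polynomial ℝ,
    Tendsto (fun k => eLpNorm (fun x => (p k).eval x - f x) 2 (densMeasure ρ)) atTop (𝓝 0) ∧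
    Tendsto (fun k => eLpNorm (fun x => secOp ρ (fun t => (p k).eval t) x - g x) 2
      (densMeasure μ)) atTop (𝓝 0)

end SecondaryMeasure

end

/-! Write H(x) for the principal value of ∫ ρ(t)/(x - t) dt, so that φ = 2H. Above an interior
point, S_ρ(x + iε) is the conjugate Poisson integral of ρ minus i times its Poisson integral, hence
tends to H(x) - iπρ(x) wherever H(x) exists. At a point where μ is a Lebesgue point for the Poisson
kernel, the imaginary part of the coupling gives μ = ρ/(H² + π²ρ²) and the real part gives ψ/2 = x -
c₁ - Hμ/ρ (`IsSecondaryDensity.eq_div`, `IsSecondaryDensity.tendsto_conjPoissonInt`). The null set N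
consists of the other points. At Lebesgue points truncated integrals and conjugate Poisson integrals
also have the same limits, so principal values can be read off from boundary values of Stieltjes
transforms.

For Lipschitz ρ the function H exists on all of (0,1). Statement (a) rests on (μ/ρ)gρ = gμ almost
everywhere: both sides then contain the same singular integral of gμ, which cancels and leaves only
H and the principal value of μ. This requires μ = 0 almost everywhere on {ρ = 0}. The dangerous
points are those with ρ = H = 0, where S_μ blows up; Kolmogorov's inequality (a bound on ∫ |S|^(1/2)
in terms of the L¹ norm) makes them a null set. Absolute convergence in (a) follows because H varies
by O(√|y - x|) near each x, so that μ/ρ does too, up to null sets, near a point with ρ(x) ≠ 0.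

For (b), expanding the coupling at infinity turns it into an identity between moments. By pure
algebra T_ρ is then isometric on polynomials of ρ-mean zero, and q ↦ (x - c₁)q - T_μ(q) is a right
inverse with values of mean zero (`apply_secPoly_mul_secPoly`, `secPoly_primitive`). Approximate g
uniformly by polynomials q_k with error 4^(-k). The preimages converge in L²(ρ) by the isometry, and
Kolmogorov's inequality applied to (q_k - g)μ gives T_μ(q_k) → T_μ(g) ρ-almost everywhere, which
identifies the limit as f (`ae_tendsto_primPoly`). In the limit S_{fρ} = S_ρ S_{gμ}; the real part
of its boundary values, with the formula for μ, is the integral equation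
(`ae_tendsto_truncSecOp_solution`). -/

noncomputable section

namespace SecondaryMeasure

/-! ### Poisson kernel and Lebesgue points -/

/-- The Poisson kernel of the upper half-plane, up to the factor `π`. -/
def poissonKer (x ε t : ℝ) : ℝ := ε / ((x - t) ^ 2 + ε ^ 2)

/-- The conjugate Poisson kernel of the upper half-plane, up to the factor `π`. -/
def conjPoissonKer (x ε t : ℝ) : ℝ := (x - t) / ((x - t) ^ 2 + ε ^ 2)

/-- The Poisson integral of `h` over `[0, 1]`. -/
def poissonInt (h : ℝ → ℝ) (x ε : ℝ) : ℝ := ∫ t in Icc (0 : ℝ) 1, poissonKer x ε t * h t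

/-- The conjugate Poisson integral of `h` over `[0, 1]`. -/
def conjPoissonInt (h : ℝ → ℝ) (x ε : ℝ) : ℝ := ∫ t in Icc (0 : ℝ) 1, conjPoissonKer x ε t * h t

/-- A Lebesgue point of `h`, in the sense of averages against the Poisson kernel. -/
def IsPoissonLebesguePoint (h : ℝ → ℝ) (x : ℝ) : Prop :=
  Tendsto (fun ε : ℝ => ∫⁻ t in Icc (0 : ℝ) 1, ENNReal.ofReal (poissonKer x ε t) * ‖h t - h x‖ₑ)
    (𝓝[>] 0) (𝓝 0)

theorem poissonKer_denom_pos {ε : ℝ} (hε : 0 < ε) (x t : ℝ) : 0 < (x - t) ^ 2 + ε ^ 2 := by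
  positivity

theorem poissonKer_nonneg {ε : ℝ} (hε : 0 < ε) (x t : ℝ) : 0 ≤ poissonKer x ε t := by
  unfold poissonKer; positivity

theorem continuous_poissonKer {ε : ℝ} (hε : 0 < ε) (x : ℝ) : Continuous (poissonKer x ε) := by
  unfold poissonKer
  exact continuous_const.div (by fun_prop) fun t => (poissonKer_denom_pos hε x t).ne'

theorem continuous_conjPoissonKer {ε : ℝ} (hε : 0 < ε) (x : ℝ) :
    Continuous (conjPoissonKer x ε) := by
  unfold conjPoissonKer
  exact Continuous.div (by fun_prop) (by fun_prop) fun t => (poissonKer_denom_pos hε x t).ne'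

theorem poissonKer_eq {ε : ℝ} (hε : 0 < ε) (x t : ℝ) :
    poissonKer x ε t = ε⁻¹ * (1 + ((t - x) * ε⁻¹) ^ 2)⁻¹ := by
  have h2 : 1 + ((t - x) * ε⁻¹) ^ 2 = ((x - t) ^ 2 + ε ^ 2) / ε ^ 2 := by field_simp; ring
  rw [h2, poissonKer]
  have := poissonKer_denom_pos hε x t
  field_simp

theorem integrable_poissonKer {ε : ℝ} (hε : 0 < ε) (x : ℝ) : Integrable (poissonKer x ε) := by
  rw [show poissonKer x ε = _ from funext (poissonKer_eq hε x)]
  have h1 : Integrable fun t : ℝ => (1 + (t * ε⁻¹) ^ 2)⁻¹ :=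
    integrable_inv_one_add_sq.comp_mul_right' (inv_ne_zero hε.ne')
  exact (h1.comp_sub_right x).const_mul _

theorem integral_poissonKer {ε : ℝ} (hε : 0 < ε) (x : ℝ) :
    ∫ t, poissonKer x ε t = Real.pi := by
  simp_rw [poissonKer_eq hε x]
  rw [integral_const_mul, integral_sub_right_eq_self (fun t : ℝ => (1 + (t * ε⁻¹) ^ 2)⁻¹),
    Measure.integral_comp_mul_right (fun t : ℝ => (1 + t ^ 2)⁻¹), integral_univ_inv_one_add_sq,
    inv_inv, abs_of_pos hε, smul_eq_mul]
  field_simp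

theorem lintegral_poissonKer {ε : ℝ} (hε : 0 < ε) (x : ℝ) :
    ∫⁻ t, ENNReal.ofReal (poissonKer x ε t) = ENNReal.ofReal Real.pi := by
  rw [← integral_poissonKer hε x, ofReal_integral_eq_lintegral_ofReal (integrable_poissonKer hε x)
    (Eventually.of_forall (poissonKer_nonneg hε x))]

/-- The kernel is radially decreasing, so its superlevel sets are balls. For τ ≥ 1/ε the radicand is
nonpositive, `√` returns 0 and the ball is empty, as it should be. -/
theorem setOf_lt_poissonKer {ε τ : ℝ} (hε : 0 < ε) (hτ : 0 < τ) (x : ℝ) :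
    {t | τ < poissonKer x ε t} = Metric.ball x √(ε / τ - ε ^ 2) := by
  ext t
  rw [mem_ofPred_eq, Metric.mem_ball, Real.dist_eq, Real.lt_sqrt (abs_nonneg _), sq_abs, poissonKer,
    lt_div_iff₀ (poissonKer_denom_pos hε x t), lt_sub_iff_add_lt, lt_div_iff₀ hτ, mul_comm,
    show (t - x) ^ 2 = (x - t) ^ 2 by ring]

/-- A measure with density at most `η` on all balls about `x` is dominated by `η` times Lebesgue
measure against radially decreasing functions, in particular against the Poisson kernel. -/
theorem lintegral_poissonKer_le {ν : Measure ℝ} {η : ENNReal} {x ε : ℝ} (hε : 0 < ε)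
    (h : ∀ r, ν (Metric.ball x r) ≤ η * volume (Metric.ball x r)) :
    ∫⁻ t, ENNReal.ofReal (poissonKer x ε t) ∂ν ≤ η * ENNReal.ofReal Real.pi := by
  rw [← lintegral_poissonKer hε x]
  -- Layer-cake formula on both sides; the comparison then takes place on each superlevel set, which
  -- is a ball.
  rw [lintegral_eq_lintegral_meas_lt ν
    (Eventually.of_forall (poissonKer_nonneg hε x)) (continuous_poissonKer hε x).measurable.aemeasurable,
    lintegral_eq_lintegral_meas_lt volume
    (Eventually.of_forall (poissonKer_nonneg hε x)) (continuous_poissonKer hε x).measurable.aemeasurable]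
  have hmv : Measurable fun τ : ℝ => volume {a | τ < poissonKer x ε a} := by
    refine Antitone.measurable fun a b hab => measure_mono fun t ht => ?_
    exact lt_of_le_of_lt hab ht
  rw [← lintegral_const_mul _ hmv]
  refine setLIntegral_mono' measurableSet_Ioi fun τ hτ => ?_
  rw [setOf_lt_poissonKer hε hτ]
  exact h _

/-- Within distance d of x, `lintegral_poissonKer_le` applies to the measure |h(t) - h(x)| dt;
farther away the kernel is at most ε/d², which tends to 0 against a finite integral. -/
theorem isPoissonLebesguePoint_of_averages {h : ℝ → ℝ} (hh : IntegrableOn h (Icc 0 1)) {x : ℝ}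
    (H : ∀ η : ENNReal, 0 < η → ∃ d > 0, ∀ r, 0 < r → r ≤ d →
      ∫⁻ t in Icc (0 : ℝ) 1 ∩ Metric.ball x r, ‖h t - h x‖ₑ ≤ η * volume (Metric.ball x r)) :
    IsPoissonLebesguePoint h x := by
  have hint : IntegrableOn (fun t => h t - h x) (Icc 0 1) := hh.sub (integrable_const _)
  have hfin : ∫⁻ t in Icc (0 : ℝ) 1, ‖h t - h x‖ₑ ≠ ⊤ := hint.2.ne
  set C := ∫⁻ t in Icc (0 : ℝ) 1, ‖h t - h x‖ₑ with hC
  have hmeas : AEMeasurable (fun t => ‖h t - h x‖ₑ) (volume.restrict (Icc 0 1)) :=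
    hint.1.enorm
  rw [IsPoissonLebesguePoint, ENNReal.tendsto_nhds_zero]
  intro e he
  have hpi : ENNReal.ofReal Real.pi ≠ 0 := by simp [Real.pi_pos]
  have hpi' : ENNReal.ofReal Real.pi ≠ ⊤ := ENNReal.ofReal_ne_top
  -- The kernel has total mass π, so this η makes the near part at most e/2.
  obtain ⟨d, hd, hdr⟩ := H (e / 2 / ENNReal.ofReal Real.pi)
    (ENNReal.div_pos (ENNReal.half_pos he.ne').ne' hpi')
  have hlim : Tendsto (fun ε : ℝ => ENNReal.ofReal (ε / d ^ 2) * C) (𝓝[>] 0) (𝓝 0) := by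
    have h1 : Tendsto (fun ε : ℝ => ENNReal.ofReal (ε / d ^ 2)) (𝓝[>] 0) (𝓝 0) := by
      have : Tendsto (fun ε : ℝ => ENNReal.ofReal (ε / d ^ 2)) (𝓝 0) (𝓝 (ENNReal.ofReal (0 / d ^ 2))) :=
        (ENNReal.continuous_ofReal.comp (continuous_id.div_const _)).tendsto 0
      simp only [zero_div, ENNReal.ofReal_zero] at this
      exact this.mono_left nhdsWithin_le_nhds
    simpa using ENNReal.Tendsto.mul_const h1 (Or.inr hfin)
  have hev := (ENNReal.tendsto_nhds_zero.1 hlim) (e / 2) (ENNReal.half_pos he.ne')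
  filter_upwards [hev, self_mem_nhdsWithin] with ε hε1 (hε : 0 < ε)
  rw [← lintegral_inter_add_sdiff _ (Icc (0 : ℝ) 1) (measurableSet_ball (x := x) (ε := d)),
    ← ENNReal.add_halves e]
  refine add_le_add ?_ (le_trans ?_ hε1)
  · set ν := (volume.restrict (Icc (0 : ℝ) 1 ∩ Metric.ball x d)).withDensity
      fun t => ‖h t - h x‖ₑ with hν
    have hmeas' : AEMeasurable (fun t => ‖h t - h x‖ₑ)
        (volume.restrict (Icc (0 : ℝ) 1 ∩ Metric.ball x d)) :=
      hmeas.mono_measure (Measure.restrict_mono inter_subset_left le_rfl)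
    have key := lintegral_poissonKer_le (ν := ν) (η := e / 2 / ENNReal.ofReal Real.pi) (x := x) hε
      fun r => by
        rw [hν, withDensity_apply _ measurableSet_ball, Measure.restrict_restrict measurableSet_ball]
        rcases le_or_gt r 0 with hr | hr
        · simp [Metric.ball_eq_empty.2 hr]
        -- ν is carried by the ball of radius d, so a larger ball has no more mass than that one.
        · have hm : 0 < min r d := lt_min hr hd
          calc _ ≤ ∫⁻ t in Icc (0 : ℝ) 1 ∩ Metric.ball x (min r d), ‖h t - h x‖ₑ := by
                refine lintegral_mono_set fun t ht => ⟨ht.2.1, ?_⟩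
                exact lt_min (Metric.mem_ball.1 ht.1) (Metric.mem_ball.1 ht.2.2)
            _ ≤ _ := hdr _ hm (min_le_right _ _)
            _ ≤ _ := by gcongr; exact min_le_left _ _
    rw [ENNReal.div_mul_cancel hpi hpi', hν, lintegral_withDensity_eq_lintegral_mul₀ hmeas'
      (continuous_poissonKer hε x).measurable.ennreal_ofReal.aemeasurable] at key
    refine le_trans (le_of_eq ?_) key
    exact lintegral_congr fun t => by simp [mul_comm]
  · rw [hC, ← lintegral_const_mul' _ _ ENNReal.ofReal_ne_top]
    refine le_trans (setLIntegral_mono' (measurableSet_Icc.diff measurableSet_ball)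
      fun t ht => ?_) (lintegral_mono_set sdiff_subset)
    gcongr
    rw [poissonKer]
    have h1 : d ≤ |t - x| := by simpa [Real.dist_eq] using ht.2
    have h2 : d ^ 2 ≤ (x - t) ^ 2 := by
      rw [show (x - t) ^ 2 = |t - x| ^ 2 by rw [sq_abs]; ring]; gcongr
    gcongr
    nlinarith

theorem isPoissonLebesguePoint_of_continuousAt {h : ℝ → ℝ} (hh : IntegrableOn h (Icc 0 1)) {x : ℝ}
    (hx : ContinuousAt h x) : IsPoissonLebesguePoint h x := by
  refine isPoissonLebesguePoint_of_averages hh fun η hη => ?_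
  have h1 : Tendsto (fun t => ‖h t - h x‖ₑ) (𝓝 x) (𝓝 0) := by
    have : Tendsto (fun t => ‖h t - h x‖ₑ) (𝓝 x) (𝓝 ‖h x - h x‖ₑ) :=
      (hx.sub tendsto_const_nhds).enorm
    simpa using this
  obtain ⟨d, hd, hdη⟩ := Metric.eventually_nhds_iff_ball.1 ((ENNReal.tendsto_nhds_zero.1 h1) η hη)
  refine ⟨d, hd, fun r _ hrd => ?_⟩
  calc _ ≤ ∫⁻ t in Metric.ball x r, η := by
        refine le_trans (lintegral_mono_set inter_subset_right)
          (setLIntegral_mono' measurableSet_ball fun t ht => ?_)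
        exact hdη t (Metric.ball_subset_ball hrd ht)
    _ = _ := by simp

/-- Lebesgue's differentiation theorem for the extension of h by zero, with the averages over balls
converted by `isPoissonLebesguePoint_of_averages`. -/
theorem ae_isPoissonLebesguePoint {h : ℝ → ℝ} (hh : IntegrableOn h (Icc 0 1)) :
    ∀ᵐ x, x ∈ Ioo (0 : ℝ) 1 → IsPoissonLebesguePoint h x := by
  set h' := (Icc (0 : ℝ) 1).indicator h with hh'
  have hi : Integrable h' := (integrable_indicator_iff measurableSet_Icc).2 hh
  filter_upwards [(Besicovitch.vitaliFamily (volume : Measure ℝ)).ae_tendsto_lintegral_enorm_sub_div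
    hi.locallyIntegrable] with x hx hx01
  have hx' := hx.comp (Besicovitch.tendsto_filterAt volume x)
  refine isPoissonLebesguePoint_of_averages hh fun η hη => ?_
  have := (ENNReal.tendsto_nhds_zero.1 hx') η hη
  obtain ⟨d, hd, hdη⟩ := mem_nhdsGT_iff_exists_Ioc_subset.1 this
  refine ⟨d, hd, fun r hr hrd => ?_⟩
  have h1 : (∫⁻ y in Metric.closedBall x r, ‖h' y - h' x‖ₑ) / volume (Metric.closedBall x r) ≤ η :=
    hdη ⟨hr, hrd⟩
  have hv : volume (Metric.closedBall x r) = volume (Metric.ball x r) := by simp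
  have hv0 : volume (Metric.ball x r) ≠ 0 := by simp [hr]
  have hvt : volume (Metric.ball x r) ≠ ⊤ := measure_ball_lt_top.ne
  rw [hv, ENNReal.div_le_iff hv0 hvt] at h1
  refine le_trans ?_ h1
  calc _ = ∫⁻ y in Icc (0 : ℝ) 1 ∩ Metric.ball x r, ‖h' y - h' x‖ₑ := by
        refine setLIntegral_congr_fun (measurableSet_Icc.inter measurableSet_ball) fun t ht => ?_
        simp [hh', indicator_of_mem ht.1, indicator_of_mem (Ioo_subset_Icc_self hx01)]
    _ ≤ _ := lintegral_mono_set (inter_subset_right.trans Metric.ball_subset_closedBall)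

/-! ### Principal values and conjugate Poisson integrals -/

/-- The truncated singular integral `∫ h(t) / (x - t) dt` over `t ∈ [0, 1]`, `|t - x| > ε`. -/
def truncHilbert (h : ℝ → ℝ) (x ε : ℝ) : ℝ :=
  ∫ t in Icc (0 : ℝ) 1 ∩ {t | ε < |t - x|}, h t / (x - t)

/-- The kernel of the truncated singular integral. -/
def truncKer (x ε t : ℝ) : ℝ := {t : ℝ | ε < |t - x|}.indicator (fun t => (x - t)⁻¹) t

theorem measurableSet_lt_abs_sub (x ε : ℝ) : MeasurableSet {t : ℝ | ε < |t - x|} :=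
  measurableSet_lt measurable_const (by fun_prop)

theorem measurable_truncKer (x ε : ℝ) : Measurable (truncKer x ε) :=
  Measurable.indicator (by fun_prop) (measurableSet_lt_abs_sub x ε)

theorem abs_truncKer_le {ε : ℝ} (hε : 0 < ε) (x t : ℝ) : |truncKer x ε t| ≤ ε⁻¹ := by
  unfold truncKer
  by_cases h : t ∈ {t : ℝ | ε < |t - x|}
  · rw [indicator_of_mem h, abs_inv, abs_sub_comm]
    exact inv_anti₀ hε (le_of_lt h)
  · rw [indicator_of_notMem h, abs_zero]; positivity

theorem truncHilbert_eq (h : ℝ → ℝ) (x ε : ℝ) :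
    truncHilbert h x ε = ∫ t in Icc (0 : ℝ) 1, truncKer x ε t * h t := by
  rw [truncHilbert, ← setIntegral_indicator (measurableSet_lt_abs_sub x ε)]
  refine integral_congr_ae (Eventually.of_forall fun t => ?_)
  simp only [truncKer, indicator]
  split_ifs <;> simp [div_eq_inv_mul]

theorem integrableOn_truncKer_mul {h : ℝ → ℝ} (hh : IntegrableOn h (Icc 0 1)) {ε : ℝ} (hε : 0 < ε)
    (x : ℝ) : IntegrableOn (fun t => truncKer x ε t * h t) (Icc 0 1) :=
  Integrable.bdd_mul hh (measurable_truncKer x ε).aestronglyMeasurable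
    (Eventually.of_forall fun t => by rw [Real.norm_eq_abs]; exact abs_truncKer_le hε x t)

theorem integrableOn_poissonKer_mul {h : ℝ → ℝ} (hh : IntegrableOn h (Icc 0 1)) {ε : ℝ}
    (hε : 0 < ε) (x : ℝ) : IntegrableOn (fun t => poissonKer x ε t * h t) (Icc 0 1) :=
  hh.continuousOn_mul (continuous_poissonKer hε x).continuousOn isCompact_Icc

theorem integrableOn_conjPoissonKer_mul {h : ℝ → ℝ} (hh : IntegrableOn h (Icc 0 1)) {ε : ℝ}
    (hε : 0 < ε) (x : ℝ) : IntegrableOn (fun t => conjPoissonKer x ε t * h t) (Icc 0 1) :=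
  hh.continuousOn_mul (continuous_conjPoissonKer hε x).continuousOn isCompact_Icc

/-- The truncated kernel differs from the conjugate Poisson kernel by at most the Poisson kernel. -/
theorem abs_truncKer_sub_conjPoissonKer_le {ε : ℝ} (hε : 0 < ε) (x t : ℝ) :
    |truncKer x ε t - conjPoissonKer x ε t| ≤ poissonKer x ε t := by
  unfold truncKer conjPoissonKer poissonKer
  have hD := poissonKer_denom_pos hε x t
  by_cases h : t ∈ {t : ℝ | ε < |t - x|}
  · rw [indicator_of_mem h]
    have h' : ε < |x - t| := by rw [abs_sub_comm]; exact h
    have hne : x - t ≠ 0 := abs_pos.1 (hε.trans h')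
    -- The exact difference is ε²/((x - t)((x - t)² + ε²)), and ε/|x - t| < 1 off the truncated
    -- interval.
    rw [show (x - t)⁻¹ - (x - t) / ((x - t) ^ 2 + ε ^ 2) =
      ε ^ 2 / ((x - t) * ((x - t) ^ 2 + ε ^ 2)) by field_simp; ring, abs_div, abs_mul,
      abs_of_pos hD, abs_of_pos (by positivity : 0 < ε ^ 2), ← div_div]
    gcongr
    rw [div_le_iff₀ (hε.trans h')]
    nlinarith
  · rw [indicator_of_notMem h, zero_sub, abs_neg, abs_div, abs_of_pos hD]
    have h' : |x - t| ≤ ε := by rw [abs_sub_comm]; exact not_lt.1 h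
    gcongr

/-- A kernel dominated by the Poisson kernel, with mass tending to `c`, is an approximate `c`-fold
identity at the Lebesgue points. -/
theorem tendsto_integral_of_abs_le_poissonKer {h : ℝ → ℝ} (hh : IntegrableOn h (Icc 0 1)) {x c : ℝ}
    (hx : IsPoissonLebesguePoint h x) {k : ℝ → ℝ → ℝ}
    (hk : ∀ ε > 0, ∀ u : ℝ → ℝ, IntegrableOn u (Icc 0 1) →
      IntegrableOn (fun t => k ε t * u t) (Icc 0 1))
    (hle : ∀ ε > 0, ∀ t, |k ε t| ≤ poissonKer x ε t)
    (hc : Tendsto (fun ε => ∫ t in Icc (0 : ℝ) 1, k ε t) (𝓝[>] 0) (𝓝 c)) :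
    Tendsto (fun ε => ∫ t in Icc (0 : ℝ) 1, k ε t * h t) (𝓝[>] 0) (𝓝 (c * h x)) := by
  have h1 : Tendsto (fun ε => ∫ t in Icc (0 : ℝ) 1, k ε t * (h t - h x)) (𝓝[>] 0) (𝓝 0) := by
    rw [tendsto_zero_iff_enorm_tendsto_zero]
    refine tendsto_of_tendsto_of_tendsto_of_le_of_le' tendsto_const_nhds hx
      (Eventually.of_forall fun _ => zero_le) ?_
    filter_upwards [self_mem_nhdsWithin] with ε (hε : 0 < ε)
    refine (enorm_integral_le_lintegral_enorm _).trans (lintegral_mono fun t => ?_)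
    rw [enorm_mul]
    gcongr
    rw [← ofReal_norm]
    exact ENNReal.ofReal_le_ofReal (hle ε hε t)
  have h2 := h1.add (hc.mul_const (h x))
  rw [zero_add] at h2
  refine h2.congr' ?_
  filter_upwards [self_mem_nhdsWithin] with ε (hε : 0 < ε)
  rw [← integral_mul_const, ← integral_add (hk ε hε (fun t => h t - h x) (hh.sub (integrable_const _)))
    (hk ε hε (fun _ => h x) (integrable_const _))]
  exact integral_congr_ae (Eventually.of_forall fun t => by simp only; ring)

theorem integral_poissonKer_Icc {ε : ℝ} (hε : 0 < ε) (x : ℝ) :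
    ∫ t in Icc (0 : ℝ) 1, poissonKer x ε t =
      Real.arctan ((1 - x) / ε) + Real.arctan (x / ε) := by
  rw [integral_Icc_eq_integral_Ioc, ← intervalIntegral.integral_of_le zero_le_one]
  have hd : ∀ t ∈ uIcc (0 : ℝ) 1, HasDerivAt (fun t => Real.arctan ((t - x) / ε))
      (poissonKer x ε t) t := fun t _ => by
    have h1 : HasDerivAt (fun t : ℝ => (t - x) / ε) (1 / ε) t :=
      ((hasDerivAt_id t).sub_const x).div_const ε
    convert h1.arctan using 1
    rw [poissonKer_eq hε]
    ring
  rw [intervalIntegral.integral_eq_sub_of_hasDerivAt hd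
    ((continuous_poissonKer hε x).intervalIntegrable _ _)]
  rw [zero_sub, neg_div, Real.arctan_neg, sub_neg_eq_add]

theorem integral_conjPoissonKer_Icc {ε : ℝ} (hε : 0 < ε) (x : ℝ) :
    ∫ t in Icc (0 : ℝ) 1, conjPoissonKer x ε t =
      (Real.log (x ^ 2 + ε ^ 2) - Real.log ((x - 1) ^ 2 + ε ^ 2)) / 2 := by
  rw [integral_Icc_eq_integral_Ioc, ← intervalIntegral.integral_of_le zero_le_one]
  have hd : ∀ t ∈ uIcc (0 : ℝ) 1, HasDerivAt (fun t => -(Real.log ((x - t) ^ 2 + ε ^ 2) / 2))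
      (conjPoissonKer x ε t) t := fun t _ => by
    have h1 : HasDerivAt (fun t : ℝ => (x - t) ^ 2 + ε ^ 2) (2 * (x - t) * (-1)) t := by
      have := (((hasDerivAt_id t).const_sub x).pow 2).add_const (ε ^ 2)
      simpa using this
    have h2 := ((h1.log (poissonKer_denom_pos hε x t).ne').div_const 2).neg
    refine h2.congr_deriv ?_
    rw [conjPoissonKer]
    ring
  rw [intervalIntegral.integral_eq_sub_of_hasDerivAt hd
    ((continuous_conjPoissonKer hε x).intervalIntegrable _ _)]
  rw [sub_zero]; ring

theorem tendsto_integral_poissonKer {x : ℝ} (hx : x ∈ Ioo (0 : ℝ) 1) :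
    Tendsto (fun ε => ∫ t in Icc (0 : ℝ) 1, poissonKer x ε t) (𝓝[>] 0) (𝓝 Real.pi) := by
  have key : ∀ a : ℝ, 0 < a → Tendsto (fun ε => Real.arctan (a / ε)) (𝓝[>] 0)
      (𝓝 (Real.pi / 2)) := fun a ha =>
    (Real.tendsto_arctan_atTop.mono_right nhdsWithin_le_nhds).comp
      (tendsto_inv_nhdsGT_zero.const_mul_atTop ha)
  have h := (key (1 - x) (by linarith [hx.2])).add (key x hx.1)
  rw [add_halves] at h
  refine h.congr' ?_
  filter_upwards [self_mem_nhdsWithin] with ε hε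
  rw [integral_poissonKer_Icc hε]

theorem tendsto_integral_conjPoissonKer {x : ℝ} (hx : x ∈ Ioo (0 : ℝ) 1) :
    Tendsto (fun ε => ∫ t in Icc (0 : ℝ) 1, conjPoissonKer x ε t) (𝓝[>] 0)
      (𝓝 (Real.log x - Real.log (1 - x))) := by
  have key : ∀ a : ℝ, a ≠ 0 → Tendsto (fun ε => Real.log (a ^ 2 + ε ^ 2)) (𝓝[>] 0)
      (𝓝 (2 * Real.log a)) := fun a ha => by
    have h1 : Tendsto (fun ε : ℝ => a ^ 2 + ε ^ 2) (𝓝 0) (𝓝 (a ^ 2 + 0 ^ 2)) :=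
      (by fun_prop : Continuous fun ε : ℝ => a ^ 2 + ε ^ 2).tendsto 0
    have h2 := (h1.mono_left (nhdsWithin_le_nhds (s := Ioi 0))).log (by positivity)
    simpa using h2
  have h := ((key x hx.1.ne').sub (key (x - 1) (by linarith [hx.2]))).div_const 2
  -- `Real.log` is even, so the logarithm of the negative number x - 1 is that of 1 - x.
  rw [show (2 * Real.log x - 2 * Real.log (x - 1)) / 2 = Real.log x - Real.log (1 - x) by
    rw [← Real.log_neg_eq_log (x - 1), neg_sub]; ring] at h
  refine h.congr' ?_
  filter_upwards [self_mem_nhdsWithin] with ε hε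
  rw [integral_conjPoissonKer_Icc hε]

/-- The two pieces contribute opposite multiples of log ε, which cancel: the value is exact once the
removed interval lies inside (0, 1). -/
theorem integral_truncKer {x ε : ℝ} (hε : 0 < ε) (h0 : ε < x) (h1 : ε < 1 - x) :
    ∫ t in Icc (0 : ℝ) 1, truncKer x ε t = Real.log x - Real.log (1 - x) := by
  have hset : Icc (0 : ℝ) 1 ∩ {t | ε < |t - x|} = Ico 0 (x - ε) ∪ Ioc (x + ε) 1 := by
    ext t
    simp only [mem_inter_iff, mem_Icc, mem_ofPred_eq, lt_abs, mem_union, mem_Ico, mem_Ioc]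
    constructor
    · rintro ⟨⟨a, b⟩, c | c⟩
      · right; constructor <;> linarith
      · left; constructor <;> linarith
    · rintro (⟨a, b⟩ | ⟨a, b⟩)
      · exact ⟨⟨a, by linarith⟩, Or.inr (by linarith)⟩
      · exact ⟨⟨by linarith, b⟩, Or.inl (by linarith)⟩
  have hc : ∀ a b : ℝ, x ∉ uIcc a b → IntervalIntegrable (fun t => (x - t)⁻¹) volume a b :=
    fun a b hab => ContinuousOn.intervalIntegrable <|
      ContinuousOn.inv₀ (by fun_prop) fun t ht h => hab (by rwa [sub_eq_zero.1 h])
  have hn1 : x ∉ uIcc 0 (x - ε) := by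
    rw [uIcc_of_le (by linarith)]; intro h; linarith [h.2]
  have hn2 : x ∉ uIcc (x + ε) 1 := by
    rw [uIcc_of_le (by linarith)]; intro h; linarith [h.1]
  have hd : Disjoint (Ico 0 (x - ε)) (Ioc (x + ε) 1) := by
    rw [Set.disjoint_left]; intro t h h'; linarith [h.2, h'.1]
  unfold truncKer
  rw [setIntegral_indicator (measurableSet_lt_abs_sub x ε), hset,
    setIntegral_union hd measurableSet_Ioc, integral_Ico_eq_integral_Ioc,
    ← intervalIntegral.integral_of_le (by linarith), ← intervalIntegral.integral_of_le (by linarith)]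
  · rw [intervalIntegral.integral_comp_sub_left (fun t => t⁻¹),
      intervalIntegral.integral_comp_sub_left (fun t => t⁻¹), integral_inv_of_pos (by linarith) (by linarith),
      integral_inv_of_neg (by linarith) (by linarith), sub_zero, sub_sub_cancel, Real.log_div (by linarith) hε.ne',
      show x - (x + ε) = -ε by ring, show x - 1 = -(1 - x) by ring, neg_div_neg_eq,
      Real.log_div hε.ne' (by linarith)]
    ring
  · exact ((intervalIntegrable_iff_integrableOn_Ico_of_le (by linarith)).1 (hc _ _ hn1))
  · exact ((intervalIntegrable_iff_integrableOn_Ioc_of_le (by linarith)).1 (hc _ _ hn2))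

theorem tendsto_poissonInt {h : ℝ → ℝ} (hh : IntegrableOn h (Icc 0 1)) {x : ℝ}
    (hx : x ∈ Ioo (0 : ℝ) 1) (hL : IsPoissonLebesguePoint h x) :
    Tendsto (poissonInt h x) (𝓝[>] 0) (𝓝 (Real.pi * h x)) :=
  tendsto_integral_of_abs_le_poissonKer hh hL
    (fun _ hε _ hu => integrableOn_poissonKer_mul hu hε x)
    (fun _ hε t => (abs_of_nonneg (poissonKer_nonneg hε x t)).le) (tendsto_integral_poissonKer hx)

/-- At the Lebesgue points, the truncated singular integrals and the conjugate Poisson integrals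
have the same limit behaviour. -/
theorem tendsto_truncHilbert_sub_conjPoissonInt {h : ℝ → ℝ} (hh : IntegrableOn h (Icc 0 1)) {x : ℝ}
    (hx : x ∈ Ioo (0 : ℝ) 1) (hL : IsPoissonLebesguePoint h x) :
    Tendsto (fun ε => truncHilbert h x ε - conjPoissonInt h x ε) (𝓝[>] 0) (𝓝 0) := by
  have hmin : 0 < min x (1 - x) := lt_min hx.1 (by linarith [hx.2])
  have hint : ∀ ε > 0, ∀ u : ℝ → ℝ, IntegrableOn u (Icc 0 1) →
      IntegrableOn (fun t => (truncKer x ε t - conjPoissonKer x ε t) * u t) (Icc 0 1) :=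
    fun ε hε u hu => by
      simp_rw [sub_mul]
      exact (integrableOn_truncKer_mul hu hε x).sub (integrableOn_conjPoissonKer_mul hu hε x)
  -- Both kernels have mass tending to log x - log(1 - x), so their difference is an approximate
  -- 0-fold identity.
  have h1 := tendsto_integral_of_abs_le_poissonKer (c := 0) hh hL
    (k := fun ε t => truncKer x ε t - conjPoissonKer x ε t) hint
    (fun ε hε t => abs_truncKer_sub_conjPoissonKer_le hε x t) (by
      have h2 := (tendsto_const_nhds (x := Real.log x - Real.log (1 - x))).sub
        (tendsto_integral_conjPoissonKer hx)
      rw [sub_self] at h2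
      refine h2.congr' ?_
      filter_upwards [Ioo_mem_nhdsGT hmin] with ε hε
      have ha := integrableOn_truncKer_mul (h := fun _ => 1) (integrable_const _) hε.1 x
      have hb := integrableOn_conjPoissonKer_mul (h := fun _ => 1) (integrable_const _) hε.1 x
      simp only [mul_one] at ha hb
      rw [integral_sub ha hb, integral_truncKer hε.1 (hε.2.trans_le (min_le_left _ _))
        (hε.2.trans_le (min_le_right _ _))])
  rw [zero_mul] at h1
  refine h1.congr' ?_
  filter_upwards [self_mem_nhdsWithin] with ε (hε : 0 < ε)
  rw [truncHilbert_eq, conjPoissonInt, ← integral_sub (integrableOn_truncKer_mul hh hε x)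
    (integrableOn_conjPoissonKer_mul hh hε x)]
  simp_rw [sub_mul]

theorem tendsto_truncHilbert_iff {h : ℝ → ℝ} (hh : IntegrableOn h (Icc 0 1)) {x v : ℝ}
    (hx : x ∈ Ioo (0 : ℝ) 1) (hL : IsPoissonLebesguePoint h x) :
    Tendsto (truncHilbert h x) (𝓝[>] 0) (𝓝 v) ↔
      Tendsto (conjPoissonInt h x) (𝓝[>] 0) (𝓝 v) := by
  have h0 := tendsto_truncHilbert_sub_conjPoissonInt hh hx hL
  constructor
  · intro h; simpa using h.sub h0
  · intro h; simpa using h0.add h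

/-! ### Boundary values of Stieltjes transforms and the reducer of μ -/

theorem hasReducerAt_iff {h : ℝ → ℝ} {x v : ℝ} :
    HasReducerAt h x v ↔ Tendsto (conjPoissonInt h x) (𝓝[>] 0) (𝓝 (v / 2)) := by
  have e : (fun ε : ℝ => 2 * ∫ t in Icc (0 : ℝ) 1, (x - t) * h t / ((x - t) ^ 2 + ε ^ 2)) =
      fun ε => 2 * conjPoissonInt h x ε := by
    funext ε
    rw [conjPoissonInt]
    congr 2
    funext t
    rw [conjPoissonKer]; ring
  rw [HasReducerAt, e]
  constructor
  · intro h; simpa [div_eq_inv_mul] using h.const_mul 2⁻¹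
  · intro h; simpa [mul_div_cancel₀] using h.const_mul 2

theorem HasReducerAt.reducer_eq {h : ℝ → ℝ} {x v : ℝ} (hv : HasReducerAt h x v) :
    reducer h x = v := Tendsto.limUnder_eq hv

theorem stieltjes_add_mul_I {h : ℝ → ℝ} (hh : IntegrableOn h (Icc 0 1)) {ε : ℝ} (hε : 0 < ε)
    (x : ℝ) : stieltjes h (x + ε * Complex.I) =
      (conjPoissonInt h x ε : ℂ) - (poissonInt h x ε : ℂ) * Complex.I := by
  rw [stieltjes, conjPoissonInt, poissonInt, ← integral_complex_ofReal, ← integral_complex_ofReal,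
    ← integral_mul_const, ← integral_sub]
  · refine integral_congr_ae (Eventually.of_forall fun t => ?_)
    simp only [conjPoissonKer, poissonKer]
    have hD := (poissonKer_denom_pos hε x t).ne'
    have hz : (x : ℂ) + ε * Complex.I - t ≠ 0 := fun h => hε.ne' (by simpa using congrArg Complex.im h)
    have hD' : ((x : ℂ) - t) ^ 2 + (ε : ℂ) ^ 2 ≠ 0 := by exact_mod_cast hD
    push_cast
    rw [div_eq_iff hz]
    field_simp
    linear_combination ((h t : ℂ) * ε ^ 2) * Complex.I_sq
  · exact (integrableOn_conjPoissonKer_mul hh hε x).ofReal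
  · exact ((integrableOn_poissonKer_mul hh hε x).ofReal).mul_const _

theorem tendsto_stieltjes {h : ℝ → ℝ} (hh : IntegrableOn h (Icc 0 1)) {x v : ℝ}
    (hx : x ∈ Ioo (0 : ℝ) 1) (hL : IsPoissonLebesguePoint h x)
    (hv : Tendsto (conjPoissonInt h x) (𝓝[>] 0) (𝓝 v)) :
    Tendsto (fun ε : ℝ => stieltjes h (x + ε * Complex.I)) (𝓝[>] 0)
      (𝓝 ((v : ℂ) - (Real.pi * h x : ℝ) * Complex.I)) := by
  have h1 := (Complex.continuous_ofReal.tendsto _).comp hv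
  have h2 := (Complex.continuous_ofReal.tendsto _).comp (tendsto_poissonInt hh hx hL)
  refine (h1.sub (h2.mul_const Complex.I)).congr' ?_
  filter_upwards [self_mem_nhdsWithin] with ε hε
  simp only [Function.comp, stieltjes_add_mul_I hh hε]

/-- Away from t = x the two terms of f(t) - f(x) can be integrated separately. Through this identity
every claim about T becomes one about truncated Hilbert transforms. -/
theorem truncSecOp_eq {σ f : ℝ → ℝ} (hσ : IntegrableOn σ (Icc 0 1))
    (hf : IntegrableOn (fun t => f t * σ t) (Icc 0 1)) {ε : ℝ} (hε : 0 < ε) (x : ℝ) :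
    truncSecOp σ f x ε = f x * truncHilbert σ x ε - truncHilbert (fun t => f t * σ t) x ε := by
  rw [truncSecOp, ← setIntegral_indicator (measurableSet_lt_abs_sub x ε), truncHilbert_eq,
    truncHilbert_eq, ← integral_const_mul,
    ← integral_sub ((integrableOn_truncKer_mul hσ hε x).const_mul _)
      (integrableOn_truncKer_mul hf hε x)]
  refine integral_congr_ae (Eventually.of_forall fun t => ?_)
  simp only [truncKer, secKernel, indicator]
  split_ifs with h
  · have : t - x ≠ 0 := abs_pos.1 (hε.trans h)
    rw [← neg_sub t x, inv_neg]
    field_simp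
    ring
  · simp

theorem add_mul_I_notMem {ε : ℝ} (hε : 0 < ε) (x : ℝ) :
    (x : ℂ) + ε * Complex.I ∉ (fun t : ℝ => (t : ℂ)) '' Icc (0 : ℝ) 1 := by
  rintro ⟨t, -, ht⟩
  exact hε.ne (by simpa using congrArg Complex.im ht)

theorem IsProbDensity.isPoissonLebesguePoint {ρ : ℝ → ℝ} (hρ : IsProbDensity ρ) {x : ℝ}
    (hx : x ∈ Ioo (0 : ℝ) 1) : IsPoissonLebesguePoint ρ x :=
  isPoissonLebesguePoint_of_continuousAt hρ.integrable
    (hρ.continuousOn.continuousAt (isOpen_Ioo.mem_nhds hx))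

theorem IsSecondaryDensity.conjPoissonInt_eq {ρ μ : ℝ → ℝ} (hρ : IsProbDensity ρ)
    (hμ : IsSecondaryDensity ρ μ) {ε : ℝ} (hε : 0 < ε) (x : ℝ) :
    conjPoissonInt μ x ε = x - firstMoment ρ -
      conjPoissonInt ρ x ε / (conjPoissonInt ρ x ε ^ 2 + poissonInt ρ x ε ^ 2) := by
  have h := congrArg Complex.re (hμ.coupling _ (add_mul_I_notMem hε x))
  rw [stieltjes_add_mul_I hμ.integrable hε, stieltjes_add_mul_I hρ.integrable hε] at h
  simpa [Complex.normSq_apply, ← sq] using h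

theorem IsSecondaryDensity.poissonInt_eq {ρ μ : ℝ → ℝ} (hρ : IsProbDensity ρ)
    (hμ : IsSecondaryDensity ρ μ) {ε : ℝ} (hε : 0 < ε) (x : ℝ) :
    poissonInt μ x ε =
      poissonInt ρ x ε / (conjPoissonInt ρ x ε ^ 2 + poissonInt ρ x ε ^ 2) - ε := by
  have h := congrArg Complex.im (hμ.coupling _ (add_mul_I_notMem hε x))
  rw [stieltjes_add_mul_I hμ.integrable hε, stieltjes_add_mul_I hρ.integrable hε] at h
  simp [Complex.normSq_apply, ← sq] at h
  linarith

/-- The secondary density is `ρ / (v² + π² ρ²)`, where `2 v` is the reducer of `ρ`. -/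
theorem IsSecondaryDensity.eq_div {ρ μ : ℝ → ℝ} (hρ : IsProbDensity ρ)
    (hμ : IsSecondaryDensity ρ μ) {x v : ℝ} (hx : x ∈ Ioo (0 : ℝ) 1)
    (hL : IsPoissonLebesguePoint μ x) (hv : Tendsto (conjPoissonInt ρ x) (𝓝[>] 0) (𝓝 v))
    (hne : v ^ 2 + (Real.pi * ρ x) ^ 2 ≠ 0) :
    μ x = ρ x / (v ^ 2 + (Real.pi * ρ x) ^ 2) := by
  have hp := tendsto_poissonInt hρ.integrable hx (hρ.isPoissonLebesguePoint hx)
  have hm := tendsto_poissonInt hμ.integrable hx hL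
  have hε : Tendsto (fun ε : ℝ => ε) (𝓝[>] 0) (𝓝 0) := tendsto_id.mono_left nhdsWithin_le_nhds
  have h1 := (hp.div ((hv.pow 2).add (hp.pow 2)) hne).sub hε
  have h2 := tendsto_nhds_unique hm (h1.congr' (by
    filter_upwards [self_mem_nhdsWithin] with ε hε
    rw [hμ.poissonInt_eq hρ hε]; rfl))
  have := Real.pi_ne_zero
  rw [sub_zero, mul_div_assoc] at h2
  exact mul_left_cancel₀ this h2

/-- The conjugate Poisson integrals of the secondary density converge where those of `ρ` do. -/
theorem IsSecondaryDensity.tendsto_conjPoissonInt {ρ μ : ℝ → ℝ} (hρ : IsProbDensity ρ)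
    (hμ : IsSecondaryDensity ρ μ) {x v : ℝ} (hx : x ∈ Ioo (0 : ℝ) 1)
    (hL : IsPoissonLebesguePoint μ x) (hv : Tendsto (conjPoissonInt ρ x) (𝓝[>] 0) (𝓝 v))
    (hne : ρ x ≠ 0) :
    Tendsto (conjPoissonInt μ x) (𝓝[>] 0) (𝓝 (x - firstMoment ρ - v * μ x / ρ x)) := by
  have hp := tendsto_poissonInt hρ.integrable hx (hρ.isPoissonLebesguePoint hx)
  have hpi := Real.pi_ne_zero
  have hne' : v ^ 2 + (Real.pi * ρ x) ^ 2 ≠ 0 := by positivity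
  have h1 := (tendsto_const_nhds (x := x - firstMoment ρ)).sub
    (hv.div ((hv.pow 2).add (hp.pow 2)) hne')
  rw [hμ.eq_div hρ hx hL hv hne']
  have e : x - firstMoment ρ - v * (ρ x / (v ^ 2 + (Real.pi * ρ x) ^ 2)) / ρ x =
      x - firstMoment ρ - v / (v ^ 2 + (Real.pi * ρ x) ^ 2) := by
    field_simp
  rw [e]
  refine h1.congr' ?_
  filter_upwards [self_mem_nhdsWithin] with ε hε
  rw [hμ.conjPoissonInt_eq hρ hε]; rfl

theorem IsSecondaryDensity.hasReducerAt {ρ μ : ℝ → ℝ} (hρ : IsProbDensity ρ)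
    (hμ : IsSecondaryDensity ρ μ) {x φ : ℝ} (hx : x ∈ Ioo (0 : ℝ) 1)
    (hL : IsPoissonLebesguePoint μ x) (hφ : HasReducerAt ρ x φ) (hne : ρ x ≠ 0) :
    HasReducerAt μ x (2 * (x - firstMoment ρ) - φ * μ x / ρ x) := by
  rw [hasReducerAt_iff] at hφ ⊢
  have := hμ.tendsto_conjPoissonInt hρ hx hL hφ hne
  rwa [show (2 * (x - firstMoment ρ) - φ * μ x / ρ x) / 2 =
    x - firstMoment ρ - φ / 2 * μ x / ρ x by ring]

/-! ### Hilbert transform of a Lipschitz density -/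

/-- The finite Hilbert transform of a Lipschitz density. -/
def lipHilbert (ρ : ℝ → ℝ) (x : ℝ) : ℝ :=
  ρ x * (Real.log x - Real.log (1 - x)) - ∫ t in Icc (0 : ℝ) 1, (ρ t - ρ x) / (t - x)

theorem abs_slope_le {ρ : ℝ → ℝ} {K : NNReal} (hK : LipschitzOnWith K ρ (Icc 0 1)) {x t : ℝ}
    (hx : x ∈ Icc (0 : ℝ) 1) (ht : t ∈ Icc (0 : ℝ) 1) : |(ρ t - ρ x) / (t - x)| ≤ K := by
  rw [abs_div]
  exact div_le_of_le_mul₀ (abs_nonneg _) K.2 (hK.dist_le_mul t ht x hx)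

theorem integrableOn_slope {ρ : ℝ → ℝ} (hi : IntegrableOn ρ (Icc 0 1)) {K : NNReal}
    (hK : LipschitzOnWith K ρ (Icc 0 1)) {x : ℝ} (hx : x ∈ Icc (0 : ℝ) 1) :
    IntegrableOn (fun t => (ρ t - ρ x) / (t - x)) (Icc 0 1) := by
  refine Integrable.of_bound ?_ K ?_
  · simp_rw [div_eq_mul_inv]
    exact (hi.1.sub aestronglyMeasurable_const).mul
      (by fun_prop : Measurable fun t : ℝ => (t - x)⁻¹).aestronglyMeasurable
  · exact (ae_restrict_iff' measurableSet_Icc).2 (Eventually.of_forall fun t ht => abs_slope_le hK hx ht)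

/-- Subtracting ρ(x) from the density leaves an integrand bounded by the Lipschitz constant, so
dominated convergence applies; the constant ρ(x) contributes the logarithms. -/
theorem tendsto_conjPoissonInt_of_lipschitz {ρ : ℝ → ℝ} (hi : IntegrableOn ρ (Icc 0 1)) {K : NNReal}
    (hK : LipschitzOnWith K ρ (Icc 0 1)) {x : ℝ} (hx : x ∈ Ioo (0 : ℝ) 1) :
    Tendsto (conjPoissonInt ρ x) (𝓝[>] 0) (𝓝 (lipHilbert ρ x)) := by
  have hx' := Ioo_subset_Icc_self hx
  have h1 : Tendsto (fun ε => ∫ t in Icc (0 : ℝ) 1, conjPoissonKer x ε t * (ρ t - ρ x)) (𝓝[>] 0)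
      (𝓝 (∫ t in Icc (0 : ℝ) 1, -((ρ t - ρ x) / (t - x)))) := by
    refine tendsto_integral_filter_of_dominated_convergence (fun _ => (K : ℝ)) ?_ ?_
      (integrable_const _) ?_
    · filter_upwards [self_mem_nhdsWithin] with ε (hε : 0 < ε)
      exact (integrableOn_conjPoissonKer_mul (hi.sub (integrable_const (ρ x))) hε x).1
    · filter_upwards [self_mem_nhdsWithin] with ε (hε : 0 < ε)
      refine (ae_restrict_iff' measurableSet_Icc).2 (Eventually.of_forall fun t ht => ?_)
      have hb := hK.dist_le_mul t ht x hx'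
      rw [Real.dist_eq, Real.dist_eq] at hb
      rw [norm_mul, Real.norm_eq_abs, Real.norm_eq_abs, conjPoissonKer, abs_div,
        abs_of_pos (poissonKer_denom_pos hε x t), div_mul_eq_mul_div,
        div_le_iff₀ (poissonKer_denom_pos hε x t)]
      have e : |x - t| * |t - x| = (x - t) ^ 2 := by rw [abs_sub_comm t x, abs_mul_abs_self, sq]
      calc |x - t| * |ρ t - ρ x| ≤ |x - t| * (K * |t - x|) := by gcongr
        _ = K * (x - t) ^ 2 := by rw [← e]; ring
        _ ≤ _ := by gcongr; nlinarith
    · have hne : ∀ᵐ t ∂(volume.restrict (Icc (0 : ℝ) 1)), t ≠ x :=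
        ae_restrict_of_ae (Measure.ae_ne volume x)
      filter_upwards [hne] with t ht
      have hxt : x - t ≠ 0 := sub_ne_zero.2 ht.symm
      have h2 : Tendsto (fun ε : ℝ => conjPoissonKer x ε t * (ρ t - ρ x)) (𝓝 0)
          (𝓝 (conjPoissonKer x 0 t * (ρ t - ρ x))) := by
        refine Tendsto.mul_const _ ?_
        have : ContinuousAt (fun ε : ℝ => (x - t) / ((x - t) ^ 2 + ε ^ 2)) 0 :=
          ContinuousAt.div (by fun_prop) (by fun_prop) (by positivity)
        exact this
      convert h2.mono_left nhdsWithin_le_nhds using 2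
      rw [conjPoissonKer, ← neg_sub x t]
      field_simp
      ring
  have h3 := ((tendsto_integral_conjPoissonKer hx).const_mul (ρ x)).add h1
  rw [integral_neg, ← sub_eq_add_neg] at h3
  refine h3.congr' ?_
  filter_upwards [self_mem_nhdsWithin] with ε (hε : 0 < ε)
  have ha := integrableOn_conjPoissonKer_mul (h := fun _ => 1) (integrable_const _) hε x
  simp only [mul_one] at ha
  have hb := integrableOn_conjPoissonKer_mul (h := fun t => ρ t - ρ x) (hi.sub (integrable_const (ρ x))) hε x
  rw [← integral_const_mul, ← integral_add (ha.const_mul _) hb, conjPoissonInt]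
  exact integral_congr_ae (Eventually.of_forall fun t => by simp only; ring)

theorem integrableOn_inv_sqrt_abs_sub {x : ℝ} (hx : x ∈ Icc (0 : ℝ) 1) :
    IntegrableOn (fun t => (√|t - x|)⁻¹) (Icc 0 1) := by
  have h1 : IntervalIntegrable (fun t : ℝ => (√|t|)⁻¹) volume 0 1 := by
    have := intervalIntegral.intervalIntegrable_rpow' (a := 0) (b := 1) (r := -(1 / 2)) (by norm_num)
    refine this.congr fun t ht => ?_
    rw [uIoc_of_le zero_le_one] at ht
    rw [abs_of_pos ht.1, Real.sqrt_eq_rpow, Real.rpow_neg ht.1.le]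
  have h2 : IntervalIntegrable (fun t : ℝ => (√|t|)⁻¹) volume (-1) 0 := by
    have := (h1.comp_sub_left 0).symm
    simpa using this
  have h3 := (h2.trans h1).comp_sub_right x
  rw [intervalIntegrable_iff_integrableOn_Icc_of_le (by linarith)] at h3
  exact h3.mono_set (Icc_subset_Icc (by linarith [hx.2]) (by linarith [hx.1]))

/-- With a = |y - x|/|t - x|, the difference is at most 2K because each slope is at most K, and at
most 2Ka by the algebraic identity below; then min(1, a) ≤ √a. The resulting singularity in t is
integrable. -/
theorem abs_slope_sub_slope_le {ρ : ℝ → ℝ} {K : NNReal} (hK : LipschitzOnWith K ρ (Icc 0 1))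
    {x y t : ℝ} (hx : x ∈ Icc (0 : ℝ) 1) (hy : y ∈ Icc (0 : ℝ) 1) (ht : t ∈ Icc (0 : ℝ) 1)
    (htx : t ≠ x) (hty : t ≠ y) :
    |(ρ t - ρ y) / (t - y) - (ρ t - ρ x) / (t - x)| ≤ 2 * K * √|y - x| * (√|t - x|)⁻¹ := by
  have h0 : 0 < |t - x| := abs_pos.2 (sub_ne_zero.2 htx)
  have hs : 0 < √|t - x| := Real.sqrt_pos.2 h0
  have hqx := abs_slope_le hK hx ht
  have hqy := abs_slope_le hK hy ht
  have hK0 : (0 : ℝ) ≤ K := K.2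
  rw [← div_eq_mul_inv]
  rcases le_total |t - x| |y - x| with h | h
  · rw [le_div_iff₀ hs]
    have h1 : |(ρ t - ρ y) / (t - y) - (ρ t - ρ x) / (t - x)| ≤ 2 * K :=
      (abs_sub _ _).trans (by linarith)
    have h2 : √|t - x| ≤ √|y - x| := Real.sqrt_le_sqrt h
    gcongr
  · have e1 : t - x ≠ 0 := sub_ne_zero.2 htx
    have e2 : t - y ≠ 0 := sub_ne_zero.2 hty
    have e : (ρ t - ρ y) / (t - y) - (ρ t - ρ x) / (t - x) =
        ((ρ t - ρ y) / (t - y) * (y - x) - (ρ y - ρ x)) / (t - x) := by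
      field_simp; ring
    have h1 := hK.dist_le_mul y hy x hx
    rw [Real.dist_eq, Real.dist_eq] at h1
    rw [e, abs_div, div_le_div_iff₀ h0 hs]
    have h2 : |(ρ t - ρ y) / (t - y) * (y - x) - (ρ y - ρ x)| ≤ 2 * K * |y - x| := by
      refine (abs_sub _ _).trans ?_
      rw [abs_mul]
      nlinarith [mul_le_mul_of_nonneg_right hqy (abs_nonneg (y - x))]
    have h3 : √|y - x| ≤ √|t - x| := Real.sqrt_le_sqrt h
    have e3 := Real.mul_self_sqrt (abs_nonneg (y - x))
    have e4 := Real.mul_self_sqrt (abs_nonneg (t - x))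
    calc _ ≤ 2 * K * |y - x| * √|t - x| := by gcongr
      _ = 2 * K * √|y - x| * (√|y - x| * √|t - x|) := by
          linear_combination -(2 * K * √|t - x|) * e3
      _ ≤ 2 * K * √|y - x| * (√|t - x| * √|t - x|) := by gcongr
      _ = _ := by rw [e4]

theorem isBigO_sub_sqrt (x : ℝ) : (fun y => y - x) =O[𝓝 x] fun y => √|y - x| := by
  refine Asymptotics.IsBigO.of_bound 1 ?_
  filter_upwards [Metric.ball_mem_nhds x one_pos] with y hy
  rw [Metric.mem_ball, Real.dist_eq] at hy
  rw [Real.norm_eq_abs, Real.norm_eq_abs, abs_of_nonneg (Real.sqrt_nonneg _), one_mul]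
  exact Real.le_sqrt_of_sq_le (by nlinarith [abs_nonneg (y - x)])

/-- The exponent 1/2 is not optimal; a positive power is all that is needed for division by t - x to
leave an integrable singularity. -/
theorem lipHilbert_isBigO {ρ : ℝ → ℝ} (hi : IntegrableOn ρ (Icc 0 1)) {K : NNReal}
    (hK : LipschitzOnWith K ρ (Icc 0 1)) {x : ℝ} (hx : x ∈ Ioo (0 : ℝ) 1) :
    (fun y => lipHilbert ρ y - lipHilbert ρ x) =O[𝓝 x] fun y => √|y - x| := by
  have hx' := Ioo_subset_Icc_self hx
  have hρ : (fun y => ρ y - ρ x) =O[𝓝 x] fun y => y - x := by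
    refine Asymptotics.IsBigO.of_bound K ?_
    filter_upwards [Icc_mem_nhds hx.1 hx.2] with y hy
    simpa [Real.dist_eq] using hK.dist_le_mul y hy x hx'
  have hlog : DifferentiableAt ℝ (fun y : ℝ => Real.log y - Real.log (1 - y)) x := by
    refine DifferentiableAt.sub (by simpa using hx.1.ne') ?_
    exact DifferentiableAt.log (by fun_prop) (by linarith [hx.2])
  have h1 : (fun y => ρ y * (Real.log y - Real.log (1 - y)) -
      ρ x * (Real.log x - Real.log (1 - x))) =O[𝓝 x] fun y => √|y - x| := by
    have ha := hρ.mul (hlog.continuousAt.tendsto.isBigO_one ℝ)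
    have hb := (hlog.isBigO_sub).const_mul_left (ρ x)
    simp only [mul_one] at ha
    refine ((ha.add hb).congr_left fun y => ?_).trans (isBigO_sub_sqrt x)
    ring
  have h2 : (fun y => (∫ t in Icc (0 : ℝ) 1, (ρ t - ρ y) / (t - y)) -
      ∫ t in Icc (0 : ℝ) 1, (ρ t - ρ x) / (t - x)) =O[𝓝 x] fun y => √|y - x| := by
    refine Asymptotics.IsBigO.of_bound (2 * K * ∫ t in Icc (0 : ℝ) 1, (√|t - x|)⁻¹) ?_
    filter_upwards [Icc_mem_nhds hx.1 hx.2] with y hy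
    rw [← integral_sub (integrableOn_slope hi hK hy) (integrableOn_slope hi hK hx'),
      Real.norm_of_nonneg (Real.sqrt_nonneg _)]
    rw [show (2 * K * ∫ t in Icc (0 : ℝ) 1, (√|t - x|)⁻¹) * √|y - x| =
      ∫ t in Icc (0 : ℝ) 1, 2 * K * √|y - x| * (√|t - x|)⁻¹ by rw [integral_const_mul]; ring]
    refine norm_integral_le_of_norm_le ((integrableOn_inv_sqrt_abs_sub hx').const_mul _) ?_
    filter_upwards [ae_restrict_mem measurableSet_Icc, ae_restrict_of_ae (Measure.ae_ne volume x),
      ae_restrict_of_ae (Measure.ae_ne volume y)] with t ht htx hty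
    exact abs_slope_sub_slope_le hK hx' hy ht htx hty
  refine (h1.sub h2).congr_left fun y => ?_
  rw [lipHilbert, lipHilbert]; ring

/-- The function inverted here is H² + π²ρ², whose inverse agrees with μ/ρ almost everywhere on {ρ ≠
0}; ρ(x) ≠ 0 keeps it away from zero near x. -/
theorem inv_lipHilbert_isBigO {ρ : ℝ → ℝ} (hi : IntegrableOn ρ (Icc 0 1)) {K : NNReal}
    (hK : LipschitzOnWith K ρ (Icc 0 1)) {x : ℝ} (hx : x ∈ Ioo (0 : ℝ) 1) (hne : ρ x ≠ 0) :
    (fun y => (lipHilbert ρ y ^ 2 + (Real.pi * ρ y) ^ 2)⁻¹ -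
      (lipHilbert ρ x ^ 2 + (Real.pi * ρ x) ^ 2)⁻¹) =O[𝓝 x] fun y => √|y - x| := by
  have hρ : (fun y => ρ y - ρ x) =O[𝓝 x] fun y => √|y - x| := by
    refine Asymptotics.IsBigO.trans ?_ (isBigO_sub_sqrt x)
    refine Asymptotics.IsBigO.of_bound K ?_
    filter_upwards [Icc_mem_nhds hx.1 hx.2] with y hy
    simpa [Real.dist_eq] using hK.dist_le_mul y hy x (Ioo_subset_Icc_self hx)
  have hH := lipHilbert_isBigO hi hK hx
  have hs : Tendsto (fun y => √|y - x|) (𝓝 x) (𝓝 0) := by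
    have : Continuous fun y => √|y - x| := by fun_prop
    simpa using this.tendsto x
  have tρ : Tendsto ρ (𝓝 x) (𝓝 (ρ x)) := tendsto_sub_nhds_zero_iff.1 (hρ.trans_tendsto hs)
  have tH : Tendsto (lipHilbert ρ) (𝓝 x) (𝓝 (lipHilbert ρ x)) :=
    tendsto_sub_nhds_zero_iff.1 (hH.trans_tendsto hs)
  set D : ℝ → ℝ := fun y => lipHilbert ρ y ^ 2 + (Real.pi * ρ y) ^ 2 with hD
  have hpi := Real.pi_ne_zero
  have hDx : D x ≠ 0 := by simp only [hD]; positivity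
  have tD : Tendsto D (𝓝 x) (𝓝 (D x)) := (tH.pow 2).add ((tρ.const_mul _).pow 2)
  have h1 : (fun y => D x - D y) =O[𝓝 x] fun y => √|y - x| := by
    have ha := hH.mul ((tH.add_const (lipHilbert ρ x)).isBigO_one ℝ)
    have hb := (hρ.mul ((tρ.add_const (ρ x)).isBigO_one ℝ)).const_mul_left (Real.pi ^ 2)
    simp only [mul_one] at ha hb
    refine ((ha.add hb).neg_left).congr_left fun y => ?_
    simp only [hD]; ring
  have h2 := h1.mul (((tD.mul_const (D x)).inv₀ (mul_ne_zero hDx hDx)).isBigO_one ℝ)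
  simp only [mul_one] at h2
  refine h2.congr' ?_ EventuallyEq.rfl
  filter_upwards [tD.eventually_ne hDx] with y hy
  rw [inv_sub_inv hy hDx, div_eq_mul_inv]

/-! ### Kolmogorov's inequality and boundary sizes -/

theorem abs_im_le_norm_sub (z : ℂ) (t : ℝ) : |z.im| ≤ ‖z - t‖ := by
  simpa using Complex.abs_im_le_norm (z - t)

theorem aestronglyMeasurable_cauchyKer {h : ℝ → ℝ} (hh : IntegrableOn h (Icc 0 1)) (z : ℂ) :
    AEStronglyMeasurable (fun t : ℝ => (h t : ℂ) / (z - t)) (volume.restrict (Icc 0 1)) := by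
  simp_rw [div_eq_mul_inv]
  have h1 : IntegrableOn (fun t => (h t : ℂ)) (Icc 0 1) := hh.ofReal
  exact h1.1.mul (by fun_prop : Measurable fun t : ℝ => (z - (t : ℂ))⁻¹).aestronglyMeasurable

theorem norm_cauchyKer_le {h : ℝ → ℝ} {z : ℂ} {t d : ℝ} (hd : 0 < d) (h1 : d ≤ ‖z - t‖) :
    ‖(h t : ℂ) / (z - t)‖ ≤ |h t| / d := by
  rw [norm_div, Complex.norm_real, Real.norm_eq_abs]
  gcongr

theorem integrableOn_cauchyKer {h : ℝ → ℝ} (hh : IntegrableOn h (Icc 0 1)) {z : ℂ} {d : ℝ}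
    (hd : 0 < d) (hz : ∀ t ∈ Icc (0 : ℝ) 1, d ≤ ‖z - t‖) :
    IntegrableOn (fun t : ℝ => (h t : ℂ) / (z - t)) (Icc 0 1) :=
  Integrable.mono' (hh.abs.div_const d) (aestronglyMeasurable_cauchyKer hh z)
    ((ae_restrict_iff' measurableSet_Icc).2
      (Eventually.of_forall fun t ht => norm_cauchyKer_le hd (hz t ht)))

theorem norm_stieltjes_le {h : ℝ → ℝ} (hh : IntegrableOn h (Icc 0 1)) {z : ℂ} {d : ℝ}
    (hd : 0 < d) (hz : ∀ t ∈ Icc (0 : ℝ) 1, d ≤ ‖z - t‖) :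
    ‖stieltjes h z‖ ≤ (∫ t in Icc (0 : ℝ) 1, |h t|) / d := by
  rw [← integral_div]
  exact norm_integral_le_of_norm_le (hh.abs.div_const d) ((ae_restrict_iff' measurableSet_Icc).2
      (Eventually.of_forall fun t ht => norm_cauchyKer_le hd (hz t ht)))

theorem differentiableAt_stieltjes {h : ℝ → ℝ} (hh : IntegrableOn h (Icc 0 1)) {z : ℂ}
    (hz : 0 < z.im) : DifferentiableAt ℂ (stieltjes h) z := by
  have hball : ∀ w ∈ Metric.ball z (z.im / 2), z.im / 2 ≤ w.im := fun w hw => by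
    have h1 := (Complex.abs_im_le_norm (w - z)).trans_lt (mem_ball_iff_norm.1 hw)
    rw [Complex.sub_im] at h1
    linarith [(abs_lt.1 h1).1]
  have hne : ∀ w ∈ Metric.ball z (z.im / 2), ∀ t : ℝ, w - t ≠ 0 := fun w hw t h0 => by
    have := congrArg Complex.im h0
    simp at this
    linarith [hball w hw]
  refine (hasDerivAt_integral_of_dominated_loc_of_deriv_le
    (μ := volume.restrict (Icc (0 : ℝ) 1)) (F := fun w (t : ℝ) => (h t : ℂ) / (w - t))
    (F' := fun w (t : ℝ) => -(h t : ℂ) / (w - t) ^ 2)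
    (bound := fun t => |h t| / (z.im / 2) ^ 2)
    (Metric.ball_mem_nhds z (half_pos hz))
    (Eventually.of_forall fun w => aestronglyMeasurable_cauchyKer hh w)
    (integrableOn_cauchyKer hh hz fun t _ => (le_abs_self _).trans (abs_im_le_norm_sub z t)) ?_ ?_
    (hh.abs.div_const _) ?_).2.differentiableAt
  · have h1 : IntegrableOn (fun t => (h t : ℂ)) (Icc 0 1) := hh.ofReal
    simp_rw [div_eq_mul_inv]
    exact h1.1.neg.mul
      (by fun_prop : Measurable fun t : ℝ => ((z - (t : ℂ)) ^ 2)⁻¹).aestronglyMeasurable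
  · refine Eventually.of_forall fun t w hw => ?_
    rw [norm_div, norm_neg, norm_pow, Complex.norm_real, Real.norm_eq_abs]
    have := (hball w hw).trans ((le_abs_self _).trans (abs_im_le_norm_sub w t))
    gcongr
  · refine Eventually.of_forall fun t w hw => ?_
    have h1 := (hasDerivAt_const w (h t : ℂ)).div ((hasDerivAt_id w).sub_const (t : ℂ)) (hne w hw t)
    refine h1.congr_deriv ?_
    simp

theorem continuous_stieltjes_add_mul_I {h : ℝ → ℝ} (hh : IntegrableOn h (Icc 0 1)) {ε : ℝ}
    (hε : 0 < ε) : Continuous fun x : ℝ => stieltjes h (x + ε * Complex.I) := by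
  refine continuous_iff_continuousAt.2 fun x => ?_
  have h1 : ContinuousAt (stieltjes h) (x + ε * Complex.I) :=
    (differentiableAt_stieltjes hh (by simpa using hε)).continuousAt
  exact ContinuousAt.comp (f := fun x : ℝ => (x : ℂ) + ε * Complex.I) h1 (by fun_prop)

theorem poissonInt_pos {h : ℝ → ℝ} (hh : IntegrableOn h (Icc 0 1))
    (h0 : ∀ᵐ t ∂(volume.restrict (Icc (0 : ℝ) 1)), 0 ≤ h t) (hm : 0 < ∫ t in Icc (0 : ℝ) 1, h t)
    {ε : ℝ} (hε : 0 < ε) (x : ℝ) : 0 < poissonInt h x ε := by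
  have hc : 0 < ε / ((|x| + 1) ^ 2 + ε ^ 2) := by positivity
  refine (mul_pos hc hm).trans_le ?_
  rw [← integral_const_mul, poissonInt]
  refine integral_mono_ae (hh.const_mul _) (integrableOn_poissonKer_mul hh hε x) ?_
  filter_upwards [h0, ae_restrict_mem measurableSet_Icc] with t ht0 ht
  unfold poissonKer
  have h1 : |x - t| ≤ |x| + 1 := (abs_sub _ _).trans (by rw [abs_of_nonneg ht.1]; linarith [ht.2])
  have h2 : (x - t) ^ 2 ≤ (|x| + 1) ^ 2 := by rw [← sq_abs]; gcongr
  gcongr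

/-- Kolmogorov's inequality, with exponent `1 / 2`, for Stieltjes transforms of nonnegative
functions. -/
theorem integral_sqrt_norm_stieltjes_le_of_nonneg {h : ℝ → ℝ} (hh : IntegrableOn h (Icc 0 1))
    (h0 : ∀ᵐ t ∂(volume.restrict (Icc (0 : ℝ) 1)), 0 ≤ h t) {ε : ℝ} (hε : 0 < ε) :
    ∫ x in (-1 : ℝ)..2, √‖stieltjes h (x + ε * Complex.I)‖ ≤
      8 * √(∫ t in Icc (0 : ℝ) 1, h t) := by
  -- Mass zero is set aside because then iS vanishes, and the strict positivity of its real part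
  -- used below fails.
  rcases (integral_nonneg_of_ae h0).eq_or_lt with hm | hm
  · have h1 := (integral_eq_zero_iff_of_nonneg_ae h0 hh).1 hm.symm
    have h2 : ∀ z, stieltjes h z = 0 := fun z => by
      rw [stieltjes]
      refine integral_eq_zero_of_ae ?_
      filter_upwards [h1] with t ht
      simp [ht]
    simp [h2]
  set m := ∫ t in Icc (0 : ℝ) 1, h t with hm_def
  have habs : ∫ t in Icc (0 : ℝ) 1, |h t| = m :=
    integral_congr_ae (by filter_upwards [h0] with t ht; exact abs_of_nonneg ht)
  set G : ℂ → ℂ := fun z => (Complex.I * stieltjes h z) ^ (2⁻¹ : ℂ) with hG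
  have hre : ∀ z : ℂ, 0 < z.im → 0 < (Complex.I * stieltjes h z).re := fun z hz => by
    have := stieltjes_add_mul_I hh hz z.re
    rw [Complex.re_add_im] at this
    rw [this]
    simpa using poissonInt_pos hh h0 hm hz z.re
  have hGd : ∀ z : ℂ, 0 < z.im → DifferentiableAt ℂ G z := fun z hz =>
    DifferentiableAt.cpow_const ((differentiableAt_stieltjes hh hz).const_mul _)
      (Or.inl (hre z hz))
  have hGn : ∀ z, ‖G z‖ = √‖stieltjes h z‖ := fun z => by
    have h1 : G z ^ 2 = Complex.I * stieltjes h z := by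
      simp [hG]
    have h2 := congrArg norm h1
    rw [norm_pow, norm_mul, Complex.norm_I, one_mul] at h2
    rw [← h2, Real.sqrt_sq (norm_nonneg _)]
  have hGre : ∀ z : ℂ, 0 < z.im → √‖stieltjes h z‖ ≤ √2 * (G z).re := fun z hz => by
    rw [hG, Complex.cpow_inv_two_re, ← Real.sqrt_mul zero_le_two]
    refine Real.sqrt_le_sqrt ?_
    have := hre z hz
    rw [norm_mul, Complex.norm_I, one_mul]
    linarith
  have hcurve : ∀ z : ℂ, (∀ t ∈ Icc (0 : ℝ) 1, 1 ≤ ‖z - t‖) → ‖G z‖ ≤ √m := fun z hz => by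
    rw [hGn]
    refine Real.sqrt_le_sqrt ?_
    simpa [habs] using norm_stieltjes_le hh one_pos hz
  -- Cauchy's theorem on [-1, 2] × [ε, 1 + ε]: the other three sides stay at distance at least 1
  -- from [0, 1], where |G| ≤ √m, and have total length 3 + 1 + 1 = 5.
  have hrect := Complex.integral_boundary_rect_eq_zero_of_differentiableOn G
    (-1 + ε * Complex.I) (2 + (1 + ε) * Complex.I) (by
      intro z hz
      refine (hGd z ?_).differentiableWithinAt
      have := hz.2
      simp only [Complex.add_im, Complex.neg_im, Complex.one_im, Complex.mul_im, Complex.ofReal_re, Complex.I_im, mem_preimage, Complex.ofReal_im, Complex.I_re, Complex.add_re, Complex.one_re] at this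
      norm_num at this
      have := this.1
      linarith)
  simp only [Complex.add_im, Complex.neg_im, Complex.one_im, Complex.mul_im, Complex.ofReal_re,
    Complex.I_im, Complex.ofReal_im, Complex.I_re, Complex.add_re, Complex.one_re, Complex.mul_re,
    Complex.neg_re, Complex.re_ofNat, Complex.im_ofNat, mul_one, mul_zero, add_zero, zero_add,
    sub_zero, neg_zero] at hrect
  have htop : ‖∫ x in (-1 : ℝ)..2, G (x + (1 + ε : ℝ) * Complex.I)‖ ≤ √m * |2 - (-1)| := by
    refine intervalIntegral.norm_integral_le_of_norm_le_const fun x _ => hcurve _ fun t _ => ?_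
    refine le_trans ?_ (abs_im_le_norm_sub _ t)
    simp
    rw [abs_of_pos] <;> linarith
  have hright : ‖∫ y in ε..(1 + ε), G ((2 : ℝ) + y * Complex.I)‖ ≤ √m * |1 + ε - ε| := by
    refine intervalIntegral.norm_integral_le_of_norm_le_const fun y _ => hcurve _ fun t ht => ?_
    refine le_trans ?_ (Complex.abs_re_le_norm _)
    simp
    rw [abs_of_pos] <;> linarith [ht.2]
  have hleft : ‖∫ y in ε..(1 + ε), G ((-1 : ℝ) + y * Complex.I)‖ ≤ √m * |1 + ε - ε| := by
    refine intervalIntegral.norm_integral_le_of_norm_le_const fun y _ => hcurve _ fun t ht => ?_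
    refine le_trans ?_ (Complex.abs_re_le_norm _)
    simp
    rw [abs_of_neg] <;> linarith [ht.1]
  have hGc : Continuous fun x : ℝ => G (x + ε * Complex.I) := by
    refine continuous_iff_continuousAt.2 fun x => ?_
    exact ContinuousAt.comp (f := fun x : ℝ => (x : ℂ) + ε * Complex.I)
      (hGd _ (by simpa using hε)).continuousAt (by fun_prop)
  have hbot : ‖∫ x in (-1 : ℝ)..2, G (x + ε * Complex.I)‖ ≤ 5 * √m := by
    have e : ∫ x in (-1 : ℝ)..2, G (x + ε * Complex.I) =
        (∫ x in (-1 : ℝ)..2, G (x + (1 + ε : ℝ) * Complex.I)) -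
        Complex.I • (∫ y in ε..(1 + ε), G ((2 : ℝ) + y * Complex.I)) +
        Complex.I • ∫ y in ε..(1 + ε), G ((-1 : ℝ) + y * Complex.I) := by
      push_cast at hrect ⊢
      linear_combination hrect
    rw [e]
    refine (norm_add_le _ _).trans ((add_le_add_left (norm_sub_le _ _) _).trans ?_)
    rw [norm_smul, norm_smul, Complex.norm_I, one_mul, one_mul]
    norm_num at htop hright hleft ⊢
    linarith
  have hint : ∫ x in (-1 : ℝ)..2, (G (x + ε * Complex.I)).re ≤ 5 * √m := by
    refine le_trans ?_ hbot
    refine le_trans ?_ (Complex.re_le_norm _)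
    have := Complex.reCLM.intervalIntegral_comp_comm (hGc.intervalIntegrable (μ := volume) (-1) 2)
    exact this.le
  calc _ ≤ ∫ x in (-1 : ℝ)..2, √2 * (G (x + ε * Complex.I)).re := by
        refine intervalIntegral.integral_mono_on (by norm_num) ?_ ?_ fun x _ =>
          hGre _ (by simpa using hε)
        · exact ((continuous_stieltjes_add_mul_I hh hε).norm.sqrt).intervalIntegrable _ _
        · exact ((Complex.continuous_re.comp hGc).const_mul _).intervalIntegrable _ _
    _ ≤ √2 * (5 * √m) := by rw [intervalIntegral.integral_const_mul]; gcongr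
    _ ≤ 8 * √m := by
        -- 1.6 · 5 = 8.
        have : √2 ≤ 1.6 := by rw [Real.sqrt_le_left (by norm_num)]; norm_num
        nlinarith [Real.sqrt_nonneg m]

theorem lintegral_sqrt_norm_stieltjes_le_of_nonneg {h : ℝ → ℝ} (hh : IntegrableOn h (Icc 0 1))
    (h0 : ∀ᵐ t ∂(volume.restrict (Icc (0 : ℝ) 1)), 0 ≤ h t) {ε : ℝ} (hε : 0 < ε) :
    ∫⁻ x in Ioo (0 : ℝ) 1, ENNReal.ofReal √‖stieltjes h (x + ε * Complex.I)‖ ≤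
      ENNReal.ofReal (8 * √(∫ t in Icc (0 : ℝ) 1, h t)) := by
  have hc := (continuous_stieltjes_add_mul_I hh hε).norm.sqrt
  refine le_trans ?_ (ENNReal.ofReal_le_ofReal (integral_sqrt_norm_stieltjes_le_of_nonneg hh h0 hε))
  rw [intervalIntegral.integral_of_le (by norm_num), ofReal_integral_eq_lintegral_ofReal
    ((hc.intervalIntegrable (-1) 2).1) (Eventually.of_forall fun x => Real.sqrt_nonneg _)]
  exact lintegral_mono_set fun x hx => ⟨by linarith [hx.1], by linarith [hx.2]⟩

theorem stieltjes_sub {h k : ℝ → ℝ} (hh : IntegrableOn h (Icc 0 1)) (hk : IntegrableOn k (Icc 0 1))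
    {z : ℂ} (hz : 0 < z.im) :
    stieltjes (fun t => h t - k t) z = stieltjes h z - stieltjes k z := by
  have hd : ∀ t ∈ Icc (0 : ℝ) 1, z.im ≤ ‖z - t‖ :=
    fun t _ => (le_abs_self _).trans (abs_im_le_norm_sub z t)
  rw [stieltjes, stieltjes, stieltjes, ← integral_sub (integrableOn_cauchyKer hh hz hd)
    (integrableOn_cauchyKer hk hz hd)]
  exact integral_congr_ae (Eventually.of_forall fun t => by simp only; push_cast; ring)

/-- Kolmogorov's inequality, with exponent `1 / 2`, for Stieltjes transforms. -/
theorem lintegral_sqrt_norm_stieltjes_le {h : ℝ → ℝ} (hh : IntegrableOn h (Icc 0 1))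
    {ε : ℝ} (hε : 0 < ε) :
    ∫⁻ x in Ioo (0 : ℝ) 1, ENNReal.ofReal √‖stieltjes h (x + ε * Complex.I)‖ ≤
      ENNReal.ofReal (16 * √(∫ t in Icc (0 : ℝ) 1, |h t|)) := by
  have hp : IntegrableOn (fun t => max (h t) 0) (Icc 0 1) := hh.pos_part
  have hn : IntegrableOn (fun t => max (-h t) 0) (Icc 0 1) := hh.neg_part
  have hle : ∀ k : ℝ → ℝ, IntegrableOn k (Icc 0 1) → (∀ t, 0 ≤ k t) → (∀ t, k t ≤ |h t|) →
      ∫⁻ x in Ioo (0 : ℝ) 1, ENNReal.ofReal √‖stieltjes k (x + ε * Complex.I)‖ ≤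
        ENNReal.ofReal (8 * √(∫ t in Icc (0 : ℝ) 1, |h t|)) := fun k hk hk0 hkh => by
    refine (lintegral_sqrt_norm_stieltjes_le_of_nonneg hk (Eventually.of_forall hk0) hε).trans ?_
    have := integral_mono hk hh.abs hkh
    gcongr
  have hsum := add_le_add (hle _ hp (fun t => le_max_right _ _)
      fun t => max_le (le_abs_self _) (abs_nonneg _))
    (hle _ hn (fun t => le_max_right _ _) fun t => max_le (neg_le_abs _) (abs_nonneg _))
  rw [← ENNReal.ofReal_add (by positivity) (by positivity), ← add_mul,
    show (8 : ℝ) + 8 = 16 by norm_num] at hsum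
  refine le_trans ?_ hsum
  rw [← lintegral_add_left ((continuous_stieltjes_add_mul_I hp hε).norm.sqrt.measurable.ennreal_ofReal)]
  refine lintegral_mono fun x => ?_
  simp only
  rw [← ENNReal.ofReal_add (Real.sqrt_nonneg _) (Real.sqrt_nonneg _)]
  refine ENNReal.ofReal_le_ofReal ?_
  have e : stieltjes h (x + ε * Complex.I) = stieltjes (fun t => max (h t) 0) (x + ε * Complex.I) -
      stieltjes (fun t => max (-h t) 0) (x + ε * Complex.I) := by
    rw [← stieltjes_sub hp hn (by simpa using hε)]
    congr 1
    funext t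
    rcases le_total (h t) 0 with h1 | h1 <;> simp [h1]
  rw [e]
  refine (Real.sqrt_le_sqrt (norm_sub_le _ _)).trans ?_
  rw [Real.sqrt_le_left (by positivity), add_sq, Real.sq_sqrt (norm_nonneg _),
    Real.sq_sqrt (norm_nonneg _)]
  have := mul_nonneg (Real.sqrt_nonneg ‖stieltjes (fun t => max (h t) 0) (x + ε * Complex.I)‖)
    (Real.sqrt_nonneg ‖stieltjes (fun t => max (-h t) 0) (x + ε * Complex.I)‖)
  linarith

/-- The vertical sequence `1 / (n + 1)` along which boundary values are taken. -/
def height (n : ℕ) : ℝ := 1 / ((n : ℝ) + 1)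

theorem height_pos (n : ℕ) : 0 < height n := Nat.one_div_pos_of_nat

theorem tendsto_height : Tendsto height atTop (𝓝[>] 0) :=
  tendsto_nhdsWithin_iff.2
    ⟨tendsto_one_div_add_atTop_nhds_zero_nat, Eventually.of_forall height_pos⟩

/-- The lower boundary size, to the power `1 / 2`, of a Stieltjes transform. -/
def boundarySize (h : ℝ → ℝ) (x : ℝ) : ENNReal :=
  liminf (fun n => ENNReal.ofReal √‖stieltjes h (x + height n * Complex.I)‖) atTop

theorem measurable_boundarySize {h : ℝ → ℝ} (hh : IntegrableOn h (Icc 0 1)) :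
    Measurable (boundarySize h) :=
  Measurable.liminf fun n =>
    (continuous_stieltjes_add_mul_I hh (height_pos n)).norm.sqrt.measurable.ennreal_ofReal

/-- Fatou's lemma along the heights 1/(n + 1). Taking a lower limit avoids any appeal to the
existence of boundary values. -/
theorem lintegral_boundarySize_le {h : ℝ → ℝ} (hh : IntegrableOn h (Icc 0 1)) :
    ∫⁻ x in Ioo (0 : ℝ) 1, boundarySize h x ≤
      ENNReal.ofReal (16 * √(∫ t in Icc (0 : ℝ) 1, |h t|)) := by
  refine (lintegral_liminf_le fun n =>
    (continuous_stieltjes_add_mul_I hh (height_pos n)).norm.sqrt.measurable.ennreal_ofReal).trans ?_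
  refine (liminf_le_liminf (Eventually.of_forall fun n =>
    lintegral_sqrt_norm_stieltjes_le hh (height_pos n))).trans ?_
  simp

theorem boundarySize_eq {h : ℝ → ℝ} {x : ℝ} {w : ℂ}
    (hw : Tendsto (fun ε : ℝ => stieltjes h (x + ε * Complex.I)) (𝓝[>] 0) (𝓝 w)) :
    boundarySize h x = ENNReal.ofReal √‖w‖ :=
  Tendsto.liminf_eq (ENNReal.tendsto_ofReal ((hw.comp tendsto_height).norm.sqrt))

theorem ae_boundarySize_lt_top {h : ℝ → ℝ} (hh : IntegrableOn h (Icc 0 1)) :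
    ∀ᵐ x, x ∈ Ioo (0 : ℝ) 1 → boundarySize h x < ⊤ := by
  refine (ae_restrict_iff' measurableSet_Ioo).1 (ae_lt_top (measurable_boundarySize hh) ?_)
  exact ((lintegral_boundarySize_le hh).trans_lt ENNReal.ofReal_lt_top).ne

/-! ### The quotient μ/ρ and the simplified expression -/

theorem ae_nonneg_of_Ioo {ρ : ℝ → ℝ} (h : ∀ x ∈ Ioo (0 : ℝ) 1, 0 ≤ ρ x) :
    ∀ᵐ t ∂(volume.restrict (Icc (0 : ℝ) 1)), 0 ≤ ρ t := by
  rw [← restrict_Ioo_eq_restrict_Icc]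
  exact (ae_restrict_iff' measurableSet_Ioo).2 (Eventually.of_forall h)

theorem IsProbDensity.stieltjes_ne_zero {ρ : ℝ → ℝ} (hρ : IsProbDensity ρ) {ε : ℝ} (hε : 0 < ε)
    (x : ℝ) : stieltjes ρ (x + ε * Complex.I) ≠ 0 := by
  intro h
  rw [stieltjes_add_mul_I hρ.integrable hε] at h
  have h1 := congrArg Complex.im h
  have h2 := poissonInt_pos hρ.integrable (ae_nonneg_of_Ioo hρ.nonneg)
    (by rw [hρ.total_mass]; exact one_pos) hε x
  simp at h1
  linarith

/-- Where ρ(x) = 0 but H(x) ≠ 0, the formula ρ/(H² + π²ρ²) gives zero. Where both vanish, S_ρ tends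
to 0 and the coupling forces |S_μ| → ∞, which the finiteness of `boundarySize` permits only on a
null set. -/
theorem IsSecondaryDensity.ae_eq_zero {ρ μ : ℝ → ℝ} (hρ : IsProbDensity ρ)
    (hμ : IsSecondaryDensity ρ μ) {K : NNReal} (hK : LipschitzOnWith K ρ (Icc 0 1)) :
    ∀ᵐ x, x ∈ Ioo (0 : ℝ) 1 → ρ x = 0 → μ x = 0 := by
  filter_upwards [ae_isPoissonLebesguePoint hμ.integrable, ae_boundarySize_lt_top hμ.integrable]
    with x hL hB hx hρx
  have hv := tendsto_conjPoissonInt_of_lipschitz hρ.integrable hK hx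
  rcases eq_or_ne (lipHilbert ρ x) 0 with h0 | h0
  · exfalso
    have hS := tendsto_stieltjes hρ.integrable hx (hρ.isPoissonLebesguePoint hx) hv
    rw [h0, hρx] at hS
    simp only [Complex.ofReal_zero, mul_zero, zero_mul, sub_zero] at hS
    have hS' : Tendsto (fun ε : ℝ => stieltjes ρ (x + ε * Complex.I)) (𝓝[>] 0) (𝓝[≠] 0) :=
      tendsto_nhdsWithin_iff.2 ⟨hS, by
        filter_upwards [self_mem_nhdsWithin] with ε hε using hρ.stieltjes_ne_zero hε x⟩
    have hinv := (tendsto_norm_inv_nhdsNE_zero_atTop (α := ℂ)).comp hS'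
    have hlim : Tendsto (fun ε : ℝ => ‖(x : ℂ) + ε * Complex.I - firstMoment ρ‖) (𝓝[>] 0)
        (𝓝 ‖(x : ℂ) + (0 : ℝ) * Complex.I - firstMoment ρ‖) := by
      have : Continuous fun ε : ℝ => ‖(x : ℂ) + ε * Complex.I - firstMoment ρ‖ := by fun_prop
      exact (this.tendsto 0).mono_left nhdsWithin_le_nhds
    have hsum := tendsto_atTop_add_right_of_le' _ (-(‖(x : ℂ) + (0 : ℝ) * Complex.I - firstMoment ρ‖ + 1)) hinv
      (g := fun ε : ℝ => -‖(x : ℂ) + ε * Complex.I - firstMoment ρ‖) (by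
        filter_upwards [hlim.eventually (ge_mem_nhds (lt_add_one _))] with ε hε
        exact neg_le_neg hε)
    have hμS : Tendsto (fun ε : ℝ => ‖stieltjes μ (x + ε * Complex.I)‖) (𝓝[>] 0) atTop := by
      refine tendsto_atTop_mono' _ ?_ hsum
      filter_upwards [self_mem_nhdsWithin] with ε hε
      rw [hμ.coupling _ (add_mul_I_notMem hε x), one_div, norm_sub_rev _ (stieltjes ρ (x + ε * Complex.I))⁻¹]
      simp only [Function.comp]
      have := norm_sub_norm_le (stieltjes ρ (x + ε * Complex.I))⁻¹
        ((x : ℂ) + ε * Complex.I - firstMoment ρ)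
      linarith
    have htop : boundarySize μ x = ⊤ :=
      Tendsto.liminf_eq (ENNReal.tendsto_ofReal_atTop.comp
        (Real.tendsto_sqrt_atTop.comp (hμS.comp tendsto_height)))
    exact (hB hx).ne htop
  · rw [hμ.eq_div hρ hx (hL hx) hv (by positivity), hρx, zero_div]

theorem ae_restrict_Icc_of_Ioo {p : ℝ → Prop} (h : ∀ᵐ x, x ∈ Ioo (0 : ℝ) 1 → p x) :
    ∀ᵐ x ∂(volume.restrict (Icc (0 : ℝ) 1)), p x := by
  rw [← restrict_Ioo_eq_restrict_Icc]
  exact (ae_restrict_iff' measurableSet_Ioo).2 h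

theorem IsSecondaryDensity.ae_eq_mul_inv {ρ μ : ℝ → ℝ} (hρ : IsProbDensity ρ)
    (hμ : IsSecondaryDensity ρ μ) {K : NNReal} (hK : LipschitzOnWith K ρ (Icc 0 1)) :
    ∀ᵐ x ∂(volume.restrict (Icc (0 : ℝ) 1)),
      μ x = ρ x * (lipHilbert ρ x ^ 2 + (Real.pi * ρ x) ^ 2)⁻¹ := by
  refine ae_restrict_Icc_of_Ioo ?_
  filter_upwards [ae_isPoissonLebesguePoint hμ.integrable, hμ.ae_eq_zero hρ hK] with x hL h0 hx
  rcases eq_or_ne (ρ x) 0 with h | h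
  · rw [h0 hx h, h, zero_mul]
  · have := Real.pi_ne_zero
    rw [← div_eq_mul_inv]
    exact hμ.eq_div hρ hx (hL hx) (tendsto_conjPoissonInt_of_lipschitz hρ.integrable hK hx)
      (by positivity)

/-- Almost everywhere the numerator is ρ(t) times the increment of 1/(H² + π²ρ²) from x to t, hence
O(√|t - x|) near x; away from x the denominator is bounded below. -/
theorem IsSecondaryDensity.integrableOn_div {ρ μ : ℝ → ℝ} (hρ : IsProbDensity ρ)
    (hμ : IsSecondaryDensity ρ μ) {K : NNReal} (hK : LipschitzOnWith K ρ (Icc 0 1)) {x : ℝ}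
    (hx : x ∈ Ioo (0 : ℝ) 1) (hL : IsPoissonLebesguePoint μ x) (hne : ρ x ≠ 0) :
    IntegrableOn (fun t => (μ t - μ x / ρ x * ρ t) / (t - x)) (Icc 0 1) := by
  have hpi := Real.pi_ne_zero
  have hx' := Ioo_subset_Icc_self hx
  have hmx := hμ.eq_div hρ hx hL (tendsto_conjPoissonInt_of_lipschitz hρ.integrable hK hx)
    (by positivity)
  have hO := ((hρ.continuousOn.continuousAt (isOpen_Ioo.mem_nhds hx)).tendsto.isBigO_one ℝ).mul
    (inv_lipHilbert_isBigO hρ.integrable hK hx hne)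
  simp only [one_mul] at hO
  obtain ⟨C, hC⟩ := hO.bound
  obtain ⟨d, hd, hCd⟩ := Metric.eventually_nhds_iff_ball.1 hC
  have hint : IntegrableOn (fun t => μ t - μ x / ρ x * ρ t) (Icc 0 1) :=
    hμ.integrable.sub (hρ.integrable.const_mul _)
  refine Integrable.mono' (((integrableOn_inv_sqrt_abs_sub hx').const_mul |C|).add
    (hint.abs.div_const d)) ?_ ?_
  · simp_rw [div_eq_mul_inv] at hint ⊢
    exact hint.1.mul (by fun_prop : Measurable fun t : ℝ => (t - x)⁻¹).aestronglyMeasurable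
  · filter_upwards [hμ.ae_eq_mul_inv hρ hK, ae_restrict_of_ae (Measure.ae_ne volume x)] with t ht htx
    have h0 : 0 < |t - x| := abs_pos.2 (sub_ne_zero.2 htx)
    have hs : 0 < √|t - x| := Real.sqrt_pos.2 h0
    rw [Real.norm_eq_abs, abs_div]
    simp only [Pi.add_apply]
    rcases lt_or_ge |t - x| d with h | h
    · refine le_add_of_le_of_nonneg ?_ (by positivity)
      have h1 := hCd t (by simpa [Real.dist_eq] using h)
      rw [Real.norm_eq_abs, Real.norm_eq_abs, abs_of_pos hs] at h1
      rw [div_le_iff₀ h0, hmx, ht]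
      have e : ρ t * (lipHilbert ρ t ^ 2 + (Real.pi * ρ t) ^ 2)⁻¹ -
          ρ x / (lipHilbert ρ x ^ 2 + (Real.pi * ρ x) ^ 2) / ρ x * ρ t =
          ρ t * ((lipHilbert ρ t ^ 2 + (Real.pi * ρ t) ^ 2)⁻¹ -
            (lipHilbert ρ x ^ 2 + (Real.pi * ρ x) ^ 2)⁻¹) := by
        field_simp
      rw [e]
      calc _ ≤ C * √|t - x| := h1
        _ ≤ |C| * √|t - x| := by gcongr; exact le_abs_self C
        _ = |C| * (√|t - x|)⁻¹ * (√|t - x| * √|t - x|) := by field_simp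
        _ = _ := by rw [Real.mul_self_sqrt h0.le]
    · refine le_add_of_nonneg_of_le (by positivity) ?_
      gcongr

theorem truncHilbert_congr {h k : ℝ → ℝ} (hhk : h =ᵐ[volume.restrict (Icc (0 : ℝ) 1)] k) :
    truncHilbert h = truncHilbert k := by
  funext x ε
  rw [truncHilbert_eq, truncHilbert_eq]
  refine integral_congr_ae ?_
  filter_upwards [hhk] with t ht
  rw [ht]

theorem SecOpConverges.tendsto {σ f : ℝ → ℝ} {x : ℝ} (h : SecOpConverges σ f x) :
    Tendsto (truncSecOp σ f x) (𝓝[>] 0) (𝓝 (secOp σ f x)) := tendsto_nhds_limUnder h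

/-- The density `μ` is absorbed by the quotient `μ / ρ`. -/
theorem IsSecondaryDensity.ae_div_mul_eq {ρ μ : ℝ → ℝ} (hρ : IsProbDensity ρ)
    (hμ : IsSecondaryDensity ρ μ) {K : NNReal} (hK : LipschitzOnWith K ρ (Icc 0 1)) (g : ℝ → ℝ) :
    ∀ᵐ t ∂(volume.restrict (Icc (0 : ℝ) 1)), μ t / ρ t * g t * ρ t = g t * μ t := by
  filter_upwards [hμ.ae_eq_mul_inv hρ hK] with t ht
  rcases eq_or_ne (ρ t) 0 with h | h
  · rw [ht, h]; simp
  · field_simp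

theorem integrableOn_continuousOn_mul {h g : ℝ → ℝ} (hh : IntegrableOn h (Icc 0 1))
    (hg : ContinuousOn g (Icc 0 1)) : IntegrableOn (fun t => g t * h t) (Icc 0 1) :=
  hh.continuousOn_mul hg isCompact_Icc

/-- Since (μ/ρ)gρ = gμ almost everywhere, the truncations of T_ρ((μ/ρ)g) and T_μ(g) contain the same
singular integral. Their difference involves only the truncated Hilbert transforms of ρ and μ, whose
limits are known. -/
theorem IsSecondaryDensity.secOp_div_mul {ρ μ : ℝ → ℝ} (hρ : IsProbDensity ρ)
    (hμ : IsSecondaryDensity ρ μ) {K : NNReal} (hK : LipschitzOnWith K ρ (Icc 0 1)) {g : ℝ → ℝ}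
    (hg : ContinuousOn g (Icc 0 1)) {x : ℝ}
    (hx : x ∈ Ioo (0 : ℝ) 1) (hL : IsPoissonLebesguePoint μ x) (hne : ρ x ≠ 0)
    (hc : SecOpConverges μ g x) :
    Tendsto (truncSecOp ρ (fun t => μ t / ρ t * g t) x) (𝓝[>] 0)
      (𝓝 (secOp μ g x + μ x / ρ x * g x * lipHilbert ρ x -
        g x * (x - firstMoment ρ - lipHilbert ρ x * μ x / ρ x))) := by
  have hgμ : IntegrableOn (fun t => g t * μ t) (Icc 0 1) :=
    integrableOn_continuousOn_mul hμ.integrable hg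
  have hae := hμ.ae_div_mul_eq hρ hK g
  have hv := tendsto_conjPoissonInt_of_lipschitz hρ.integrable hK hx
  have hTρ := (tendsto_truncHilbert_iff hρ.integrable hx (hρ.isPoissonLebesguePoint hx)).2 hv
  have hTμ := (tendsto_truncHilbert_iff hμ.integrable hx hL).2
    (hμ.tendsto_conjPoissonInt hρ hx hL hv hne)
  refine ((hc.tendsto.add (hTρ.const_mul (μ x / ρ x * g x))).sub (hTμ.const_mul (g x))).congr' ?_
  filter_upwards [self_mem_nhdsWithin] with ε (hε : 0 < ε)
  rw [truncSecOp_eq hμ.integrable hgμ hε,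
    truncSecOp_eq hρ.integrable (hgμ.congr_fun_ae (EventuallyEq.symm hae)) hε, truncHilbert_congr hae]
  ring

/-- The two kernels differ by g(x) times the integrand of `IsSecondaryDensity.integrableOn_div`. -/
theorem IsSecondaryDensity.integrableOn_secKernel {ρ μ : ℝ → ℝ} (hρ : IsProbDensity ρ)
    (hμ : IsSecondaryDensity ρ μ) {K : NNReal} (hK : LipschitzOnWith K ρ (Icc 0 1)) {g : ℝ → ℝ}
    {x : ℝ} (hx : x ∈ Ioo (0 : ℝ) 1) (hL : IsPoissonLebesguePoint μ x) (hne : ρ x ≠ 0)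
    (hi : IntegrableOn (secKernel μ g x) (Icc 0 1)) :
    IntegrableOn (secKernel ρ (fun t => μ t / ρ t * g t) x) (Icc 0 1) := by
  refine (hi.add ((hμ.integrableOn_div hρ hK hx hL hne).const_mul (g x))).congr ?_
  filter_upwards [hμ.ae_div_mul_eq hρ hK g] with t ht
  simp only [secKernel, Pi.add_apply]
  rw [div_mul_eq_mul_div (_ - _) (t - x) (ρ t), sub_mul, ht]
  ring

/-! ### Algebra of the secondary operator on polynomials -/

section PolynomialAlgebra

open Polynomial

/-- The values on monomials of the secondary operator of a linear functional. -/
def secMonomial (L : ℝ[X] →ₗ[ℝ] ℝ) : ℕ → ℝ[X]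
  | 0 => 0
  | n + 1 => X * secMonomial L n + C (L (X ^ n))

/-- The secondary operator `p ↦ L_t ((p(t) - p(x)) / (t - x))` of a linear functional `L`. -/
def secPoly (L : ℝ[X] →ₗ[ℝ] ℝ) : ℝ[X] →ₗ[ℝ] ℝ[X] :=
  (Polynomial.basisMonomials ℝ).constr ℝ (secMonomial L)

theorem secPoly_X_pow (L : ℝ[X] →ₗ[ℝ] ℝ) (n : ℕ) : secPoly L (X ^ n) = secMonomial L n := by
  have := (Polynomial.basisMonomials ℝ).constr_basis ℝ (secMonomial L) n
  rw [coe_basisMonomials] at this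
  simp only [monomial_one_right_eq_X_pow] at this
  exact this

theorem secPoly_C (L : ℝ[X] →ₗ[ℝ] ℝ) (a : ℝ) : secPoly L (C a) = 0 := by
  have h : (C a : ℝ[X]) = a • X ^ 0 := by rw [pow_zero, smul_eq_C_mul, mul_one]
  rw [h, map_smul, secPoly_X_pow, secMonomial, smul_zero]

/-- This reflects (t p(t) - x p(x))/(t - x) = x (p(t) - p(x))/(t - x) + p(t). -/
theorem secPoly_X_mul (L : ℝ[X] →ₗ[ℝ] ℝ) (p : ℝ[X]) :
    secPoly L (X * p) = X * secPoly L p + C (L p) := by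
  induction p using Polynomial.induction_on' with
  | add p q hp hq => rw [mul_add, map_add, hp, hq, map_add, map_add, C_add]; ring
  | monomial n a =>
    rw [← C_mul_X_pow_eq_monomial, ← smul_eq_C_mul, mul_smul_comm, ← pow_succ', map_smul, map_smul,
      map_smul, secPoly_X_pow, secPoly_X_pow, secMonomial, smul_add, mul_smul_comm, smul_eq_mul, C_mul,
      smul_eq_C_mul a (p := C _)]

theorem polynomial_induction {P : ℝ[X] → Prop} (hC : ∀ a, P (C a))
    (hadd : ∀ p q, P p → P q → P (p + q)) (hX : ∀ p, P p → P (X * p)) (p : ℝ[X]) : P p := by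
  induction p using Polynomial.induction_on with
  | C a => exact hC a
  | add p q hp hq => exact hadd p q hp hq
  | monomial n a h => rw [pow_succ', mul_left_comm]; exact hX _ h

theorem secMonomial_eq_sum (L : ℝ[X] →ₗ[ℝ] ℝ) (n : ℕ) :
    secMonomial L n = ∑ i ∈ Finset.range n, C (L (X ^ (n - 1 - i))) * X ^ i := by
  induction n with
  | zero => simp [secMonomial]
  | succ n ih =>
    rw [secMonomial, ih, Finset.sum_range_succ', Finset.mul_sum]
    congr 1
    · refine Finset.sum_congr rfl fun i hi => ?_
      rw [show n + 1 - 1 - (i + 1) = n - 1 - i by omega]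
      ring
    · simp

theorem apply_secMonomial (L M : ℝ[X] →ₗ[ℝ] ℝ) (n : ℕ) :
    M (secMonomial L n) = ∑ i ∈ Finset.range n, L (X ^ (n - 1 - i)) * M (X ^ i) := by
  simp_rw [secMonomial_eq_sum, map_sum, ← smul_eq_C_mul, map_smul, smul_eq_mul]

/-- Both sides apply L and M, one in each variable, to (p(t) - p(x))/(t - x), which is symmetric in
t and x. -/
theorem apply_secPoly_comm (L M : ℝ[X] →ₗ[ℝ] ℝ) (p : ℝ[X]) :
    M (secPoly L p) = L (secPoly M p) := by
  induction p using Polynomial.induction_on' with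
  | add p q hp hq => simp only [map_add, hp, hq]
  | monomial n a =>
    rw [← C_mul_X_pow_eq_monomial, ← smul_eq_C_mul]
    simp only [map_smul, secPoly_X_pow, apply_secMonomial]
    congr 1
    rw [← Finset.sum_range_reflect]
    refine Finset.sum_congr rfl fun i hi => ?_
    have := Finset.mem_range.1 hi
    rw [show n - 1 - (n - 1 - i) = i by omega, mul_comm]

theorem map_C_mul (L : ℝ[X] →ₗ[ℝ] ℝ) (a : ℝ) (p : ℝ[X]) : L (C a * p) = a * L p := by
  rw [← smul_eq_C_mul, map_smul, smul_eq_mul]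

theorem map_C (L : ℝ[X] →ₗ[ℝ] ℝ) (a : ℝ) : L (C a) = a * L 1 := by
  rw [← map_C_mul, mul_one]

variable {L M : ℝ[X] →ₗ[ℝ] ℝ}

/-- The secondary operator is isometric on the hyperplane `L = 0`. -/
theorem apply_secPoly_mul_secPoly (h1 : L 1 = 1)
    (h : ∀ p, L (X * p) - L X * L p = M (secPoly L p)) (p q : ℝ[X]) :
    M (secPoly L p * secPoly L q) = L (p * q) - L p * L q := by
  induction p using polynomial_induction generalizing q with
  | hC a => rw [secPoly_C, zero_mul, map_zero, map_C_mul, map_C, h1]; ring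
  | hadd p r hp hr => simp only [map_add, add_mul, hp, hr]; ring
  | hX p ih =>
    -- The factor X is moved across the product: the induction on p is uniform in q, so the
    -- hypothesis is available for X q.
    have h2 := ih (X * q)
    rw [secPoly_X_mul, mul_add, map_add, mul_comm (secPoly L p) (C _), map_C_mul, ← h] at h2
    rw [secPoly_X_mul, add_mul, map_add, map_C_mul, ← h,
      show X * secPoly L p * secPoly L q = secPoly L p * (X * secPoly L q) by ring,
      show X * p * q = p * (X * q) by ring]
    linear_combination h2

/-- A preimage of `q` under the secondary operator. -/
theorem secPoly_primitive (h1 : L 1 = 1)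
    (h : ∀ p, L (X * p) - L X * L p = M (secPoly L p)) (q : ℝ[X]) :
    secPoly L (X * q - C (L X) * q - secPoly M q) = q := by
  -- In the inductive step the constant L(`secPoly` M p) is exchanged for M(`secPoly` L p), which h
  -- expresses through L alone.
  have key : secPoly L (secPoly M q) = (X - C (L X)) * secPoly L q + C (L q) - q := by
    induction q using polynomial_induction with
    | hC a => simp [secPoly_C, map_C, h1]
    | hadd p r hp hr => simp only [map_add, hp, hr]; ring
    | hX p ih =>
      rw [secPoly_X_mul, map_add, secPoly_X_mul, secPoly_C, ih, secPoly_X_mul, add_zero,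
        ← apply_secPoly_comm, ← h, C_sub, C_mul]
      ring
  rw [map_sub, map_sub, key, secPoly_X_mul, ← smul_eq_C_mul (p := q), map_smul, smul_eq_C_mul]
  ring

theorem apply_primitive (h : ∀ p, L (X * p) - L X * L p = M (secPoly L p)) (q : ℝ[X]) :
    L (X * q - C (L X) * q - secPoly M q) = 0 := by
  rw [map_sub, map_sub, map_C_mul, ← apply_secPoly_comm, ← h, sub_self]

end PolynomialAlgebra

/-! ### Moments and the coupling -/

section Moments

open Polynomial

theorem integrableOn_eval_mul {σ : ℝ → ℝ} (hσ : IntegrableOn σ (Icc 0 1)) (p : ℝ[X]) :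
    IntegrableOn (fun t => p.eval t * σ t) (Icc 0 1) :=
  integrableOn_continuousOn_mul hσ p.continuous.continuousOn

/-- The moment functional `p ↦ ∫ p σ`. -/
def moment {σ : ℝ → ℝ} (hσ : IntegrableOn σ (Icc 0 1)) : ℝ[X] →ₗ[ℝ] ℝ where
  toFun p := ∫ t in Icc (0 : ℝ) 1, p.eval t * σ t
  map_add' p q := by
    rw [← integral_add (integrableOn_eval_mul hσ p) (integrableOn_eval_mul hσ q)]
    simp only [eval_add, add_mul]
  map_smul' a p := by
    rw [RingHom.id_apply, smul_eq_mul, ← integral_const_mul]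
    simp only [eval_smul, smul_eq_mul, mul_assoc]

theorem moment_apply {σ : ℝ → ℝ} (hσ : IntegrableOn σ (Icc 0 1)) (p : ℝ[X]) :
    moment hσ p = ∫ t in Icc (0 : ℝ) 1, p.eval t * σ t := rfl

theorem integral_secKernel_polynomial {σ : ℝ → ℝ} (hσ : IntegrableOn σ (Icc 0 1)) (p : ℝ[X])
    (x : ℝ) : IntegrableOn (secKernel σ (fun t => p.eval t) x) (Icc 0 1) ∧
      ∫ t in Icc (0 : ℝ) 1, secKernel σ (fun t => p.eval t) x t = (secPoly (moment hσ) p).eval x := by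
  induction p using polynomial_induction with
  | hC a =>
    have : secKernel σ (fun t => (C a).eval t) x = fun _ => 0 := by funext t; simp [secKernel]
    rw [this, secPoly_C]
    simp
  | hadd p q hp hq =>
    have : secKernel σ (fun t => (p + q).eval t) x = fun t =>
        secKernel σ (fun t => p.eval t) x t + secKernel σ (fun t => q.eval t) x t := by
      funext t; simp only [secKernel, eval_add]; ring
    rw [this, integral_add hp.1 hq.1, hp.2, hq.2, map_add, eval_add]
    exact ⟨hp.1.add hq.1, rfl⟩
  | hX p hp =>
    have : (fun t => x * secKernel σ (fun t => p.eval t) x t + p.eval t * σ t)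
        =ᵐ[volume.restrict (Icc 0 1)] secKernel σ (fun t => (X * p).eval t) x := by
      filter_upwards [ae_restrict_of_ae (Measure.ae_ne volume x)] with t ht
      have : t - x ≠ 0 := sub_ne_zero.2 ht
      simp only [secKernel, eval_mul, eval_X]
      field_simp
      ring
    refine ⟨((hp.1.const_mul x).add (integrableOn_eval_mul hσ p)).congr this, ?_⟩
    rw [← integral_congr_ae this, integral_add (hp.1.const_mul x) (integrableOn_eval_mul hσ p),
      integral_const_mul, hp.2, secPoly_X_mul, ← moment_apply hσ p]
    simp

theorem tendsto_truncSecOp_polynomial {σ : ℝ → ℝ} (hσ : IntegrableOn σ (Icc 0 1)) (p : ℝ[X])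
    (x : ℝ) : Tendsto (truncSecOp σ (fun t => p.eval t) x) (𝓝[>] 0)
      (𝓝 ((secPoly (moment hσ) p).eval x)) := by
  obtain ⟨h1, h2⟩ := integral_secKernel_polynomial hσ p x
  obtain ⟨h3, h4⟩ := secOp_eq_integral h1
  rw [← h2]
  exact h4 ▸ h3.tendsto

theorem secOp_polynomial {σ : ℝ → ℝ} (hσ : IntegrableOn σ (Icc 0 1)) (p : ℝ[X]) (x : ℝ) :
    secOp σ (fun t => p.eval t) x = (secPoly (moment hσ) p).eval x :=
  (tendsto_truncSecOp_polynomial hσ p x).limUnder_eq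

/-- Integrate p(t)/(z - t) = p(z)/(z - t) - (p(t) - p(z))/(t - z). -/
theorem stieltjes_polynomial_mul {σ : ℝ → ℝ} (hσ : IntegrableOn σ (Icc 0 1)) (p : ℝ[X]) {z : ℂ}
    (hz : 0 < z.im) : stieltjes (fun t => p.eval t * σ t) z =
      aeval z p * stieltjes σ z - aeval z (secPoly (moment hσ) p) := by
  have hd : ∀ t ∈ Icc (0 : ℝ) 1, z.im ≤ ‖z - t‖ :=
    fun t _ => (le_abs_self _).trans (abs_im_le_norm_sub z t)
  have hi : ∀ p : ℝ[X], IntegrableOn (fun t : ℝ => ((p.eval t * σ t : ℝ) : ℂ) / (z - t)) (Icc 0 1) :=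
    fun p => integrableOn_cauchyKer (integrableOn_eval_mul hσ p) hz hd
  induction p using polynomial_induction with
  | hC a =>
    rw [secPoly_C, stieltjes, stieltjes, aeval_C, map_zero, sub_zero, ← integral_const_mul]
    refine integral_congr_ae (Eventually.of_forall fun t => ?_)
    simp [mul_div_assoc]
  | hadd p q hp hq =>
    have e : stieltjes (fun t => (p + q).eval t * σ t) z =
        stieltjes (fun t => p.eval t * σ t) z + stieltjes (fun t => q.eval t * σ t) z := by
      rw [stieltjes, stieltjes, stieltjes, ← integral_add (hi p) (hi q)]
      refine integral_congr_ae (Eventually.of_forall fun t => ?_)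
      simp only [eval_add]; push_cast; ring
    rw [e, hp, hq]
    simp only [map_add]; ring
  | hX p hp =>
    have e : stieltjes (fun t => (X * p).eval t * σ t) z =
        z * stieltjes (fun t => p.eval t * σ t) z - (moment hσ p : ℝ) := by
      have hci : IntegrableOn (fun t => ((p.eval t * σ t : ℝ) : ℂ)) (Icc 0 1) :=
        (integrableOn_eval_mul hσ p).ofReal
      rw [stieltjes, stieltjes, moment_apply, ← integral_complex_ofReal, ← integral_const_mul,
        ← integral_sub ((hi p).const_mul z) hci]
      refine integral_congr_ae (Eventually.of_forall fun t => ?_)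
      have hne : z - t ≠ 0 := fun h0 => by
        have := congrArg Complex.im h0
        simp at this
        linarith
      simp only [eval_mul, eval_X]
      push_cast
      field_simp
      ring
    rw [e, hp, secPoly_X_mul, map_add, map_mul, map_mul, aeval_X, aeval_C, Complex.coe_algebraMap]
    ring

theorem hasSum_of_eq {f g : ℕ → ℝ} {a : ℝ} (hf : HasSum f a) (h : ∀ n, f n = g n) : HasSum g a :=
  funext h ▸ hf

/-- Geometric expansion under the integral: the expansion of the Stieltjes transform at infinity,
with w = 1/z. -/
theorem hasSum_moment {σ : ℝ → ℝ} (hσ : IntegrableOn σ (Icc 0 1)) {w : ℝ} (hw : |w| < 1) :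
    Summable (fun n => ‖moment hσ (X ^ n) * w ^ n‖) ∧
    HasSum (fun n => moment hσ (X ^ n) * w ^ n) (∫ t in Icc (0 : ℝ) 1, (1 - w * t)⁻¹ * σ t) := by
  have hi : ∀ n : ℕ, IntegrableOn (fun t => t ^ n * w ^ n * σ t) (Icc 0 1) := fun n =>
    integrableOn_continuousOn_mul hσ (by fun_prop)
  have hb : ∀ n : ℕ, ∫ t in Icc (0 : ℝ) 1, ‖t ^ n * w ^ n * σ t‖ ≤
      |w| ^ n * ∫ t in Icc (0 : ℝ) 1, |σ t| := fun n => by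
    rw [← integral_const_mul]
    refine setIntegral_mono_on (hi n).norm (hσ.abs.const_mul _) measurableSet_Icc fun t ht => ?_
    rw [norm_mul, norm_mul, norm_pow, norm_pow, Real.norm_eq_abs, Real.norm_eq_abs, Real.norm_eq_abs,
      abs_of_nonneg ht.1]
    gcongr
    exact mul_le_of_le_one_left (pow_nonneg (abs_nonneg w) n) (pow_le_one₀ ht.1 ht.2)
  have hs : Summable fun n : ℕ => ∫ t in Icc (0 : ℝ) 1, ‖t ^ n * w ^ n * σ t‖ :=
    Summable.of_nonneg_of_le (fun n => integral_nonneg fun t => norm_nonneg _) hb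
      ((summable_geometric_of_lt_one (abs_nonneg w) hw).mul_right _)
  have he : ∀ n : ℕ, ∫ t in Icc (0 : ℝ) 1, t ^ n * w ^ n * σ t = moment hσ (X ^ n) * w ^ n := fun n => by
    rw [moment_apply, ← integral_mul_const]
    simp only [eval_pow, eval_X]
    exact integral_congr_ae (Eventually.of_forall fun t => by ring)
  refine ⟨Summable.of_nonneg_of_le (fun n => norm_nonneg _) (fun n => ?_) hs, ?_⟩
  · rw [← he]; exact norm_integral_le_integral_norm _
  · have h := hasSum_integral_of_summable_integral_norm hi hs
    simp_rw [he] at h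
    refine (setIntegral_congr_fun measurableSet_Icc fun t ht => ?_ :
      ∫ t in Icc (0 : ℝ) 1, (1 - w * t)⁻¹ * σ t =
        ∫ t in Icc (0 : ℝ) 1, ∑' n : ℕ, t ^ n * w ^ n * σ t) ▸ h
    rw [tsum_mul_right]
    congr 1
    simp_rw [← mul_pow, mul_comm t w]
    rw [tsum_geometric_of_norm_lt_one]
    rw [Real.norm_eq_abs, abs_mul, abs_of_nonneg ht.1]
    exact (mul_le_of_le_one_right (abs_nonneg _) ht.2).trans_lt hw

theorem stieltjes_inv {σ : ℝ → ℝ} {w : ℝ} (h0 : w ≠ 0) (hw : |w| < 1) :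
    stieltjes σ ((w⁻¹ : ℝ) : ℂ) = (w * ∫ t in Icc (0 : ℝ) 1, (1 - w * t)⁻¹ * σ t : ℝ) := by
  rw [← integral_const_mul, stieltjes, ← integral_complex_ofReal]
  refine setIntegral_congr_fun measurableSet_Icc fun t ht => ?_
  rw [← Complex.ofReal_sub, ← Complex.ofReal_div]
  congr 1
  have h1 : |w * t| < 1 := by
    rw [abs_mul, abs_of_nonneg ht.1]
    exact (mul_le_of_le_one_right (abs_nonneg _) ht.2).trans_lt hw
  have h2 : 1 - w * t ≠ 0 := by linarith [(abs_lt.1 h1).2]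
  rw [show w⁻¹ - t = (1 - w * t) / w by field_simp]
  field_simp

/-- The coupling of the Stieltjes transforms in terms of moments. -/
theorem IsSecondaryDensity.moment_coupling {ρ μ : ℝ → ℝ} (hρ : IsProbDensity ρ)
    (hμ : IsSecondaryDensity ρ μ) (p : ℝ[X]) :
    moment hρ.integrable (X * p) - moment hρ.integrable X * moment hρ.integrable p =
      moment hμ.integrable (secPoly (moment hρ.integrable) p) := by
  set L := moment hρ.integrable with hL
  set M := moment hμ.integrable with hM
  have hc1 : L X = firstMoment ρ := by simp [hL, moment_apply, firstMoment]
  have hL1 : L 1 = 1 := by simp [hL, moment_apply, hρ.total_mass]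
  set b : ℕ → ℝ := fun k => ∑ ij ∈ Finset.HasAntidiagonal.antidiagonal k, L (X ^ ij.1) * M (X ^ ij.2) with hb
  -- a k is the coefficient of w^k in w⁻¹(A - 1 - c₁wA - w²AB), where A and B are the moment
  -- generating functions of ρ and μ. The coupling at z = 1/w says that this expression vanishes.
  set a : ℕ → ℝ := fun k => L (X ^ (k + 1)) - L X * L (X ^ k) - M (secMonomial L k) with ha
  have hbM : ∀ k, M (secMonomial L (k + 1)) = b k := fun k => by
    rw [apply_secMonomial, hb]
    simp only
    rw [← Finset.Nat.sum_antidiagonal_swap, Finset.Nat.sum_antidiagonal_eq_sum_range_succ_mk]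
    rfl
  have hsum : ∀ w : ℝ, |w| < 1 → HasSum (fun n => w ^ n * a n) 0 := fun w hw => by
    rcases eq_or_ne w 0 with rfl | h0
    · have : (fun n : ℕ => (0 : ℝ) ^ n * a n) = fun _ => 0 := by
        funext n
        cases n with
        | zero => simp [ha, hL1, secMonomial]
        | succ n => simp
      rw [this]; exact hasSum_zero
    · obtain ⟨sρ, eρ⟩ : Summable (fun n => ‖L (X ^ n) * w ^ n‖) ∧
        HasSum (fun n => L (X ^ n) * w ^ n) _ := hasSum_moment hρ.integrable hw
      obtain ⟨sμ, eμ⟩ : Summable (fun n => ‖M (X ^ n) * w ^ n‖) ∧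
        HasSum (fun n => M (X ^ n) * w ^ n) _ := hasSum_moment hμ.integrable hw
      set A := ∫ t in Icc (0 : ℝ) 1, (1 - w * t)⁻¹ * ρ t with hA
      set B := ∫ t in Icc (0 : ℝ) 1, (1 - w * t)⁻¹ * μ t with hB
      have hprod : HasSum (fun n => b n * w ^ n) (A * B) := by
        have h1 := tsum_mul_tsum_eq_tsum_sum_antidiagonal_of_summable_norm sρ sμ
        have h2 := summable_norm_sum_mul_antidiagonal_of_summable_norm sρ sμ
        rw [eρ.tsum_eq, eμ.tsum_eq] at h1
        rw [h1]
        refine hasSum_of_eq h2.of_norm.hasSum fun n => ?_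
        simp only [hb]
        rw [Finset.sum_mul]
        refine Finset.sum_congr rfl fun ij hij => ?_
        rw [← Finset.HasAntidiagonal.mem_antidiagonal.1 hij, pow_add]
        ring
      -- 0 < 1 - wt < 2 on [0, 1], so A is at least half the total mass; A is a denominator in the
      -- coupling.
      have hApos : 0 < A := by
        refine lt_of_lt_of_le one_half_pos ?_
        rw [← hρ.total_mass, ← integral_div]
        refine integral_mono_ae (hρ.integrable.div_const 2) ?_ ?_
        · refine integrableOn_continuousOn_mul hρ.integrable (ContinuousOn.inv₀ (by fun_prop) ?_)
          intro t ht
          have : |w * t| < 1 := by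
            rw [abs_mul, abs_of_nonneg ht.1]
            exact (mul_le_of_le_one_right (abs_nonneg _) ht.2).trans_lt hw
          linarith [(abs_lt.1 this).2]
        · filter_upwards [ae_nonneg_of_Ioo hρ.nonneg, ae_restrict_mem measurableSet_Icc] with t h ht
          have : |w * t| < 1 := by
            rw [abs_mul, abs_of_nonneg ht.1]
            exact (mul_le_of_le_one_right (abs_nonneg _) ht.2).trans_lt hw
          rw [div_eq_inv_mul]
          gcongr
          · linarith [(abs_lt.1 this).2]
          · linarith [(abs_lt.1 this).1]
      have hcoup := hμ.coupling ((w⁻¹ : ℝ) : ℂ) (by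
        rintro ⟨t, ht, h⟩
        have h' : t = w⁻¹ := Complex.ofReal_injective h
        have h2 : t * w = 1 := by rw [h', inv_mul_cancel₀ h0]
        have h3 : |t * w| < 1 := by
          rw [abs_mul, abs_of_nonneg ht.1]
          exact (mul_le_of_le_one_left (abs_nonneg _) ht.2).trans_lt hw
        rw [h2, abs_one] at h3
        exact lt_irrefl _ h3)
      rw [stieltjes_inv h0 hw, stieltjes_inv h0 hw] at hcoup
      have hcoup' : w * B = w⁻¹ - firstMoment ρ - 1 / (w * A) := by exact_mod_cast hcoup
      have hrel : A - 1 - firstMoment ρ * w * A - w ^ 2 * (A * B) = 0 := by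
        have : w ^ 2 * (A * B) = w * A * (w * B) := by ring
        rw [this, hcoup']
        field_simp
        ring
      have h1 : HasSum (fun n => L (X ^ (n + 1)) * w ^ (n + 1)) (A - 1) := by
        have := (hasSum_nat_add_iff' 1).2 eρ
        simpa [hL1] using this
      -- The term n = 0 vanishes because `secMonomial L 0` is 0; the shift by one, together with the
      -- exponent n + 1, produces the factor w².
      have h2 : HasSum (fun n => M (secMonomial L n) * w ^ (n + 1)) (w ^ 2 * (A * B)) := by
        refine (hasSum_nat_add_iff' 1).1 ?_
        simp only [Finset.sum_range_one, secMonomial.eq_1, map_zero, zero_mul, sub_zero]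
        refine hasSum_of_eq (hprod.mul_left (w ^ 2)) fun n => ?_
        rw [hbM]; ring
      have h3 := ((h1.sub (eρ.mul_left (firstMoment ρ * w))).sub h2).mul_left w⁻¹
      rw [hrel, mul_zero] at h3
      refine hasSum_of_eq h3 fun n => ?_
      simp only [ha, hc1]
      field_simp
      ring
  -- A power series that sums to zero near the origin has zero coefficients.
  have hazero : ∀ n, a n = 0 := by
    have hF : HasFPowerSeriesAt (0 : ℝ → ℝ) (FormalMultilinearSeries.ofScalars ℝ a) 0 := by
      rw [hasFPowerSeriesAt_iff]
      filter_upwards [Metric.ball_mem_nhds (0 : ℝ) one_pos] with w hw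
      simpa [FormalMultilinearSeries.coeff_ofScalars] using hsum w (by simpa using hw)
    intro n
    rw [← FormalMultilinearSeries.coeff_ofScalars (𝕜 := ℝ) (p := a) (n := n), hF.eq_zero]
    rfl
  induction p using Polynomial.induction_on' with
  | add p q hp hq => simp only [mul_add, map_add, ← hp, ← hq]; ring
  | monomial n c =>
    rw [← C_mul_X_pow_eq_monomial, ← smul_eq_C_mul, mul_smul_comm, ← pow_succ']
    simp only [map_smul, secPoly_X_pow, smul_eq_mul]
    have := hazero n
    simp only [ha] at this
    linear_combination c * this

end Moments

/-! ### Integrals and L² norms against a density -/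

section DensMeasure

theorem aemeasurable_ofReal {σ : ℝ → ℝ} (hσ : IntegrableOn σ (Icc 0 1)) :
    AEMeasurable (fun t => ENNReal.ofReal (σ t)) (volume.restrict (Icc (0 : ℝ) 1)) :=
  hσ.1.aemeasurable.ennreal_ofReal

theorem isFiniteMeasure_densMeasure {σ : ℝ → ℝ} (hσ : IntegrableOn σ (Icc 0 1)) :
    IsFiniteMeasure (densMeasure σ) :=
  isFiniteMeasure_withDensity_ofReal hσ.2

theorem densMeasure_absolutelyContinuous (σ : ℝ → ℝ) :
    densMeasure σ ≪ volume.restrict (Icc (0 : ℝ) 1) := withDensity_absolutelyContinuous _ _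

theorem ae_densMeasure_iff {σ : ℝ → ℝ} (hσ : IntegrableOn σ (Icc 0 1)) {p : ℝ → Prop} :
    (∀ᵐ x ∂(densMeasure σ), p x) ↔ ∀ᵐ x, x ∈ Ioo (0 : ℝ) 1 → 0 < σ x → p x := by
  rw [densMeasure, ae_withDensity_iff' (aemeasurable_ofReal hσ), ← restrict_Ioo_eq_restrict_Icc,
    ae_restrict_iff' measurableSet_Ioo]
  simp only [ne_eq, ENNReal.ofReal_eq_zero, not_le]

theorem integral_densMeasure {σ : ℝ → ℝ} (hσ : IntegrableOn σ (Icc 0 1))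
    (h0 : ∀ x ∈ Ioo (0 : ℝ) 1, 0 ≤ σ x) (F : ℝ → ℝ) :
    ∫ t, F t ∂(densMeasure σ) = ∫ t in Icc (0 : ℝ) 1, F t * σ t := by
  rw [densMeasure, integral_withDensity_eq_integral_toReal_smul₀ (aemeasurable_ofReal hσ)
    (Eventually.of_forall fun _ => ENNReal.ofReal_lt_top)]
  refine integral_congr_ae ?_
  filter_upwards [ae_nonneg_of_Ioo h0] with t ht
  rw [ENNReal.toReal_ofReal ht, smul_eq_mul, mul_comm]

theorem integrableOn_mul_of_integrable_densMeasure {σ : ℝ → ℝ} (hσ : IntegrableOn σ (Icc 0 1))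
    (h0 : ∀ x ∈ Ioo (0 : ℝ) 1, 0 ≤ σ x) {F : ℝ → ℝ} (hF : Integrable F (densMeasure σ)) :
    IntegrableOn (fun t => F t * σ t) (Icc 0 1) := by
  rw [densMeasure, integrable_withDensity_iff_integrable_smul₀' (aemeasurable_ofReal hσ)
    (Eventually.of_forall fun _ => ENNReal.ofReal_lt_top)] at hF
  refine hF.congr ?_
  filter_upwards [ae_nonneg_of_Ioo h0] with t ht
  rw [ENNReal.toReal_ofReal ht, smul_eq_mul, mul_comm]

theorem aestronglyMeasurable_of_continuousOn {σ g : ℝ → ℝ} (hg : ContinuousOn g (Icc 0 1)) :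
    AEStronglyMeasurable g (densMeasure σ) :=
  (hg.aestronglyMeasurable measurableSet_Icc).mono_ac (densMeasure_absolutelyContinuous σ)

theorem ae_densMeasure_of_Icc {σ : ℝ → ℝ} {p : ℝ → Prop} (h : ∀ x ∈ Icc (0 : ℝ) 1, p x) :
    ∀ᵐ x ∂(densMeasure σ), p x :=
  (densMeasure_absolutelyContinuous σ).ae_le
    ((ae_restrict_iff' measurableSet_Icc).2 (Eventually.of_forall h))

theorem memLp_of_continuousOn {σ g : ℝ → ℝ} (hσ : IntegrableOn σ (Icc 0 1))
    (hg : ContinuousOn g (Icc 0 1)) : MemLp g 2 (densMeasure σ) := by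
  have := isFiniteMeasure_densMeasure hσ
  obtain ⟨C, hC⟩ := isCompact_Icc.exists_bound_of_continuousOn hg
  exact MemLp.of_bound (aestronglyMeasurable_of_continuousOn hg) C (ae_densMeasure_of_Icc hC)

theorem eLpNorm_le_of_Icc_bound {σ g : ℝ → ℝ} {C : ℝ} (hC : ∀ x ∈ Icc (0 : ℝ) 1, |g x| ≤ C) :
    eLpNorm g 2 (densMeasure σ) ≤
      (densMeasure σ univ) ^ (2⁻¹ : ℝ) * ENNReal.ofReal C := by
  have := eLpNorm_le_of_ae_bound (p := 2) (f := g) (μ := densMeasure σ) (ae_densMeasure_of_Icc hC)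
  simpa using this

theorem eLpNorm_polynomial {σ : ℝ → ℝ} (hσ : IntegrableOn σ (Icc 0 1))
    (h0 : ∀ x ∈ Ioo (0 : ℝ) 1, 0 ≤ σ x) (p : Polynomial ℝ) :
    eLpNorm (fun x => p.eval x) 2 (densMeasure σ) = ENNReal.ofReal √(moment hσ (p * p)) := by
  have hm := memLp_of_continuousOn hσ p.continuous.continuousOn
  rw [hm.eLpNorm_eq_integral_rpow_norm two_ne_zero ENNReal.ofNat_ne_top, moment_apply,
    ← integral_densMeasure hσ h0, Real.sqrt_eq_rpow]
  simp [← sq]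

end DensMeasure

/-! ### The isometry and its inverse on polynomials -/

section Isometry

open Polynomial

variable {ρ μ : ℝ → ℝ}

theorem moment_one (hρ : IsProbDensity ρ) : moment hρ.integrable 1 = 1 := by
  simp [moment_apply, hρ.total_mass]

theorem moment_X (hρ : IsProbDensity ρ) : moment hρ.integrable X = firstMoment ρ := by
  simp [moment_apply, firstMoment]

/-- `T_ρ` is isometric from `H_ρ` to `L²(μ)`. -/
theorem eLpNorm_sub_moment (hρ : IsProbDensity ρ) (hμ : IsSecondaryDensity ρ μ) (p : ℝ[X]) :
    eLpNorm (fun x => p.eval x - moment hρ.integrable p) 2 (densMeasure ρ) =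
      eLpNorm (fun x => (secPoly (moment hρ.integrable) p).eval x) 2 (densMeasure μ) := by
  have e : (fun x => p.eval x - moment hρ.integrable p) =
      fun x => (p - C (moment hρ.integrable p)).eval x := by funext x; simp
  rw [e, eLpNorm_polynomial hρ.integrable hρ.nonneg, eLpNorm_polynomial hμ.integrable hμ.nonneg,
    apply_secPoly_mul_secPoly (moment_one hρ) (hμ.moment_coupling hρ)]
  congr 2
  rw [sub_mul, map_sub, map_C_mul, mul_sub, map_sub, mul_comm p (C _), map_C_mul, map_sub, map_C,
    moment_one hρ]
  ring

/-- The preimage of the polynomial `q` in `H_ρ`. -/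
def primPoly (hρ : IsProbDensity ρ) (hμ : IsSecondaryDensity ρ μ) (q : ℝ[X]) : ℝ[X] :=
  X * q - C (moment hρ.integrable X) * q - secPoly (moment hμ.integrable) q

theorem secPoly_primPoly (hρ : IsProbDensity ρ) (hμ : IsSecondaryDensity ρ μ) (q : ℝ[X]) :
    secPoly (moment hρ.integrable) (primPoly hρ hμ q) = q :=
  secPoly_primitive (moment_one hρ) (hμ.moment_coupling hρ) q

theorem moment_primPoly (hρ : IsProbDensity ρ) (hμ : IsSecondaryDensity ρ μ) (q : ℝ[X]) :
    moment hρ.integrable (primPoly hρ hμ q) = 0 :=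
  apply_primitive (hμ.moment_coupling hρ) q

/-- Preimages of mean zero are as far apart in L²(ρ) as their images in L²(μ); uniform approximation
of g thus controls the preimages. -/
theorem eLpNorm_primPoly_sub (hρ : IsProbDensity ρ) (hμ : IsSecondaryDensity ρ μ) (q r : ℝ[X]) :
    eLpNorm (fun x => (primPoly hρ hμ q).eval x - (primPoly hρ hμ r).eval x) 2 (densMeasure ρ) =
      eLpNorm (fun x => q.eval x - r.eval x) 2 (densMeasure μ) := by
  have h := eLpNorm_sub_moment hρ hμ (primPoly hρ hμ q - primPoly hρ hμ r)
  simpa only [map_sub, secPoly_primPoly, moment_primPoly, sub_zero, eval_sub] using h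

/-- In this multiplicative form the relation between q and its preimage survives passage to L²
limits and to boundary values. -/
theorem stieltjes_primPoly (hρ : IsProbDensity ρ) (hμ : IsSecondaryDensity ρ μ) (q : ℝ[X]) {z : ℂ}
    (hz : 0 < z.im) :
    stieltjes (fun t => (primPoly hρ hμ q).eval t * ρ t) z =
      stieltjes ρ z * stieltjes (fun t => q.eval t * μ t) z := by
  have hne : stieltjes ρ z ≠ 0 := by
    have := hρ.stieltjes_ne_zero hz z.re
    rwa [Complex.re_add_im] at this
  have hc := hμ.coupling z (by
    have := add_mul_I_notMem hz z.re
    rwa [Complex.re_add_im] at this)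
  rw [stieltjes_polynomial_mul hρ.integrable _ hz, stieltjes_polynomial_mul hμ.integrable _ hz,
    secPoly_primPoly, hc, primPoly, moment_X hρ]
  simp only [map_sub, map_mul, aeval_X, aeval_C, Complex.coe_algebraMap]
  field_simp
  ring

end Isometry

/-! ### Convergence of the polynomial preimages to the solution -/

theorem ae_tendsto_boundarySize {h : ℕ → ℝ → ℝ} (hh : ∀ k, IntegrableOn (h k) (Icc 0 1)) {B : ℝ}
    (hB : ∀ k, ∫ t in Icc (0 : ℝ) 1, |h k t| ≤ B * (1 / 4) ^ k) :
    ∀ᵐ x, x ∈ Ioo (0 : ℝ) 1 → Tendsto (fun k => boundarySize (h k) x) atTop (𝓝 0) := by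
  have hB0 : 0 ≤ B := by
    have := (integral_nonneg fun t => abs_nonneg (h 0 t)).trans (hB 0)
    simpa using this
  -- The square root in Kolmogorov's inequality turns the rate 1/4 into 1/2, still summable; a
  -- series with finite integral converges almost everywhere, so its terms tend to 0.
  have h1 : ∀ k, ∫⁻ x in Ioo (0 : ℝ) 1, boundarySize (h k) x ≤
      ENNReal.ofReal (16 * √B * (1 / 2) ^ k) := fun k => by
    refine (lintegral_boundarySize_le (hh k)).trans (ENNReal.ofReal_le_ofReal ?_)
    rw [mul_assoc]
    gcongr
    rw [show √B * (1 / 2) ^ k = √(B * (1 / 4) ^ k) by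
      rw [Real.sqrt_mul hB0, show (1 / 4 : ℝ) ^ k = ((1 / 2) ^ k) ^ 2 by
        rw [← pow_mul, mul_comm, pow_mul]; norm_num, Real.sqrt_sq (by positivity)]]
    exact Real.sqrt_le_sqrt (hB k)
  have h2 : ∫⁻ x in Ioo (0 : ℝ) 1, ∑' k, boundarySize (h k) x ≠ ⊤ := by
    rw [lintegral_tsum fun k => (measurable_boundarySize (hh k)).aemeasurable]
    refine ne_top_of_le_ne_top ?_ (ENNReal.tsum_le_tsum h1)
    exact (Summable.tsum_ofReal_ne_top
      ((summable_geometric_of_lt_one (by norm_num) (by norm_num)).mul_left _))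
  have h3 := ae_lt_top (Measurable.tsum fun k => measurable_boundarySize (hh k)) h2
  filter_upwards [(ae_restrict_iff' measurableSet_Ioo).1 h3] with x hx hx01
  exact ENNReal.tendsto_atTop_zero_of_tsum_ne_top (hx hx01).ne

section Solution

open Polynomial

variable {ρ μ : ℝ → ℝ} {K : NNReal} {g : ℝ → ℝ} {q : ℕ → ℝ[X]}

/-- The simplified expression `(x - c₁) g(x) - T_μ(g)(x)` of the solution. -/
def solution (ρ μ g : ℝ → ℝ) (x : ℝ) : ℝ := (x - firstMoment ρ) * g x - secOp μ g x

/-- The limit of the truncated singular integrals of `g μ`. -/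
theorem tendsto_truncHilbert_mul {w : ℝ} (hμ : IntegrableOn μ (Icc 0 1))
    (hg : ContinuousOn g (Icc 0 1)) {x : ℝ} (hw : Tendsto (truncHilbert μ x) (𝓝[>] 0) (𝓝 w))
    {v : ℝ} (hc : Tendsto (truncSecOp μ g x) (𝓝[>] 0) (𝓝 v)) :
    Tendsto (truncHilbert (fun t => g t * μ t) x) (𝓝[>] 0) (𝓝 (g x * w - v)) := by
  refine ((hw.const_mul (g x)).sub hc).congr' ?_
  filter_upwards [self_mem_nhdsWithin] with ε (hε : 0 < ε)
  rw [truncSecOp_eq hμ (integrableOn_continuousOn_mul hμ hg) hε]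
  ring

theorem truncHilbert_sub {h k : ℝ → ℝ} (hh : IntegrableOn h (Icc 0 1))
    (hk : IntegrableOn k (Icc 0 1)) {ε : ℝ} (hε : 0 < ε) (x : ℝ) :
    truncHilbert (fun t => h t - k t) x ε = truncHilbert h x ε - truncHilbert k x ε := by
  rw [truncHilbert_eq, truncHilbert_eq, truncHilbert_eq, ← integral_sub
    (integrableOn_truncKer_mul hh hε x) (integrableOn_truncKer_mul hk hε x)]
  simp only [mul_sub]

theorem integral_abs_sub_mul_le (hμ0 : ∀ x ∈ Ioo (0 : ℝ) 1, 0 ≤ μ x) (hμ : IntegrableOn μ (Icc 0 1))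
    {p : ℝ[X]} (hg : ContinuousOn g (Icc 0 1)) {C : ℝ}
    (hq : ∀ x ∈ Icc (0 : ℝ) 1, |p.eval x - g x| ≤ C) :
    ∫ t in Icc (0 : ℝ) 1, |p.eval t * μ t - g t * μ t| ≤ (∫ t in Icc (0 : ℝ) 1, μ t) * C := by
  rw [← integral_mul_const]
  refine integral_mono_ae
    (((integrableOn_eval_mul hμ p).sub (integrableOn_continuousOn_mul hμ hg)).abs)
    (hμ.mul_const C) ?_
  filter_upwards [ae_nonneg_of_Ioo hμ0, ae_restrict_mem measurableSet_Icc] with t h0 ht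
  rw [← sub_mul, abs_mul, abs_of_nonneg h0, mul_comm]
  gcongr
  exact hq t ht

/-- The point is T_μ(q_k)(x) → T_μ(g)(x). The error is governed by the principal value at x of (q_k
- g)μ, the real part of a boundary value, which `boundarySize` dominates and
`ae_tendsto_boundarySize` sends to 0. -/
theorem ae_tendsto_primPoly (hρ : IsProbDensity ρ) (hμ : IsSecondaryDensity ρ μ)
    (hK : LipschitzOnWith K ρ (Icc 0 1)) (hg : ContinuousOn g (Icc 0 1))
    (hq : ∀ k, ∀ x ∈ Icc (0 : ℝ) 1, |(q k).eval x - g x| ≤ (1 / 4) ^ k)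
    (hc : ∀ᵐ x ∂(densMeasure ρ), SecOpConverges μ g x) :
    ∀ᵐ x ∂(densMeasure ρ),
      Tendsto (fun k => (primPoly hρ hμ (q k)).eval x) atTop (𝓝 (solution ρ μ g x)) := by
  rw [ae_densMeasure_iff hρ.integrable] at hc ⊢
  have hgμ := integrableOn_continuousOn_mul hμ.integrable hg
  have hi : ∀ k, IntegrableOn (fun t => (q k).eval t * μ t - g t * μ t) (Icc 0 1) :=
    fun k => (integrableOn_eval_mul hμ.integrable (q k)).sub hgμ
  filter_upwards [hc, ae_isPoissonLebesguePoint hμ.integrable,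
    ae_all_iff.2 fun k => ae_isPoissonLebesguePoint (hi k),
    ae_tendsto_boundarySize hi fun k =>
      integral_abs_sub_mul_le hμ.nonneg hμ.integrable hg (hq k)] with x hcx hL hLk hb hx hρx
  have hv := tendsto_conjPoissonInt_of_lipschitz hρ.integrable hK hx
  have hW := hμ.tendsto_conjPoissonInt hρ hx (hL hx) hv hρx.ne'
  set W := x - firstMoment ρ - lipHilbert ρ x * μ x / ρ x
  have hTW := (tendsto_truncHilbert_iff hμ.integrable hx (hL hx)).2 hW
  -- W is the principal value of μ at x, and v k that of (q k - g)μ.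
  set v : ℕ → ℝ := fun k => ((q k).eval x * W - (secPoly (moment hμ.integrable) (q k)).eval x) -
    (g x * W - secOp μ g x) with hv_def
  have hTk : ∀ k, Tendsto (truncHilbert (fun t => (q k).eval t * μ t - g t * μ t) x) (𝓝[>] 0)
      (𝓝 (v k)) := fun k => by
    have h1 := tendsto_truncHilbert_mul hμ.integrable (q k).continuous.continuousOn hTW
      (tendsto_truncSecOp_polynomial hμ.integrable (q k) x)
    have h2 := tendsto_truncHilbert_mul hμ.integrable hg hTW (hcx hx hρx).tendsto
    refine (h1.sub h2).congr' ?_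
    filter_upwards [self_mem_nhdsWithin] with ε (hε : 0 < ε)
    rw [truncHilbert_sub (integrableOn_eval_mul hμ.integrable (q k)) hgμ hε]
  have hvlim : Tendsto v atTop (𝓝 0) := by
    have h1 : ∀ k, ENNReal.ofReal √|v k| ≤
        boundarySize (fun t => (q k).eval t * μ t - g t * μ t) x := fun k => by
      rw [boundarySize_eq (tendsto_stieltjes (hi k) hx (hLk k hx)
        ((tendsto_truncHilbert_iff (hi k) hx (hLk k hx)).1 (hTk k)))]
      refine ENNReal.ofReal_le_ofReal (Real.sqrt_le_sqrt ?_)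
      refine le_trans (le_of_eq ?_) (Complex.abs_re_le_norm _)
      simp
    have h2 := tendsto_of_tendsto_of_tendsto_of_le_of_le tendsto_const_nhds (hb hx)
      (fun k => zero_le) h1
    have h3 := (ENNReal.tendsto_toReal ENNReal.zero_ne_top).comp h2
    have h4 : Tendsto (fun k => √|v k|) atTop (𝓝 0) := by
      refine h3.congr fun k => ?_
      simp [ENNReal.toReal_ofReal (Real.sqrt_nonneg _)]
    have h5 := h4.pow 2
    simp only [Real.sq_sqrt (abs_nonneg _), ne_eq, OfNat.ofNat_ne_zero, not_false_eq_true,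
      zero_pow] at h5
    exact (tendsto_zero_iff_abs_tendsto_zero _).2 h5
  have hqlim : Tendsto (fun k => (q k).eval x - g x) atTop (𝓝 0) :=
    squeeze_zero_norm (fun k => hq k x (Ioo_subset_Icc_self hx))
      (tendsto_pow_atTop_nhds_zero_of_lt_one (by norm_num) (by norm_num))
  -- The preimage of q k minus the solution equals (x - c₁ - W)(q k - g)(x) + v k.
  have h := (hqlim.const_mul (x - firstMoment ρ - W)).add (hvlim.add_const (solution ρ μ g x))
  rw [mul_zero, zero_add, zero_add] at h
  refine h.congr fun k => ?_
  rw [primPoly, moment_X hρ, hv_def, solution]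
  simp only [eval_sub, eval_mul, eval_X, eval_C]
  ring

theorem aestronglyMeasurable_solution (hρ : IsProbDensity ρ) (hμ : IsSecondaryDensity ρ μ)
    (hlim : ∀ᵐ x ∂(densMeasure ρ),
      Tendsto (fun k => (primPoly hρ hμ (q k)).eval x) atTop (𝓝 (solution ρ μ g x))) :
    AEStronglyMeasurable (solution ρ μ g) (densMeasure ρ) :=
  aestronglyMeasurable_of_tendsto_ae atTop
    (fun k => aestronglyMeasurable_of_continuousOn (primPoly hρ hμ (q k)).continuous.continuousOn)
    hlim

theorem tendsto_ofReal_pow_mul {C : ENNReal} (hC : C ≠ ⊤) (a : ℝ) :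
    Tendsto (fun k : ℕ => C * ENNReal.ofReal (a * (1 / 4) ^ k)) atTop (𝓝 0) := by
  have h1 : Tendsto (fun k : ℕ => a * (1 / 4 : ℝ) ^ k) atTop (𝓝 (a * 0)) :=
    (tendsto_pow_atTop_nhds_zero_of_lt_one (by norm_num) (by norm_num)).const_mul a
  have h2 := ENNReal.Tendsto.const_mul (ENNReal.tendsto_ofReal h1) (Or.inr hC)
  simpa using h2

theorem rpow_measure_univ_ne_top {σ : ℝ → ℝ} (hσ : IntegrableOn σ (Icc 0 1)) :
    (densMeasure σ univ) ^ (2⁻¹ : ℝ) ≠ ⊤ := by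
  have := isFiniteMeasure_densMeasure hσ
  exact ENNReal.rpow_ne_top_of_nonneg (by norm_num) (measure_ne_top _ _)

/-- Fatou in n: for n ≥ k the isometry bounds the distance between the k-th and n-th preimages by
that of q k and q n, at most 2 · 4^(-k) uniformly, and the n-th preimage tends to the solution
almost everywhere. -/
theorem tendsto_eLpNorm_sub_solution (hρ : IsProbDensity ρ) (hμ : IsSecondaryDensity ρ μ)
    (hq : ∀ k, ∀ x ∈ Icc (0 : ℝ) 1, |(q k).eval x - g x| ≤ (1 / 4) ^ k)
    (hlim : ∀ᵐ x ∂(densMeasure ρ),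
      Tendsto (fun k => (primPoly hρ hμ (q k)).eval x) atTop (𝓝 (solution ρ μ g x))) :
    Tendsto (fun k => eLpNorm (fun x => (primPoly hρ hμ (q k)).eval x - solution ρ μ g x) 2
      (densMeasure ρ)) atTop (𝓝 0) := by
  refine tendsto_of_tendsto_of_tendsto_of_le_of_le tendsto_const_nhds
    (tendsto_ofReal_pow_mul (rpow_measure_univ_ne_top hμ.integrable) 2) (fun k => zero_le)
    fun k => ?_
  have h1 := Lp.eLpNorm_lim_le_liminf_eLpNorm (p := 2) (μ := densMeasure ρ)
    (f := fun n x => (primPoly hρ hμ (q k)).eval x - (primPoly hρ hμ (q n)).eval x)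
    (fun n => aestronglyMeasurable_of_continuousOn
      ((primPoly hρ hμ (q k)).continuous.sub (primPoly hρ hμ (q n)).continuous).continuousOn)
    (fun x => (primPoly hρ hμ (q k)).eval x - solution ρ μ g x)
    (by filter_upwards [hlim] with x hx using tendsto_const_nhds.sub hx)
  refine h1.trans (liminf_le_of_frequently_le' (Eventually.frequently ?_))
  filter_upwards [eventually_ge_atTop k] with n hn
  rw [eLpNorm_primPoly_sub]
  refine eLpNorm_le_of_Icc_bound fun x hx => ?_
  have ha := hq k x hx
  have hb := (hq n x hx).trans (pow_le_pow_of_le_one (by norm_num) (by norm_num) hn)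
  rw [show (q k).eval x - (q n).eval x = ((q k).eval x - g x) - ((q n).eval x - g x) by ring]
  exact (abs_sub _ _).trans (by linarith)

theorem memLp_solution (hρ : IsProbDensity ρ) (hμ : IsSecondaryDensity ρ μ)
    (hlim : ∀ᵐ x ∂(densMeasure ρ),
      Tendsto (fun k => (primPoly hρ hμ (q k)).eval x) atTop (𝓝 (solution ρ μ g x)))
    (hL2 : Tendsto (fun k => eLpNorm (fun x => (primPoly hρ hμ (q k)).eval x - solution ρ μ g x) 2
      (densMeasure ρ)) atTop (𝓝 0)) : MemLp (solution ρ μ g) 2 (densMeasure ρ) := by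
  obtain ⟨k, hk⟩ := ((ENNReal.tendsto_nhds_zero.1 hL2) 1 one_pos).exists
  have hp := memLp_of_continuousOn hρ.integrable (primPoly hρ hμ (q k)).continuous.continuousOn
  have h1 : MemLp (fun x => (primPoly hρ hμ (q k)).eval x - solution ρ μ g x) 2 (densMeasure ρ) :=
    ⟨hp.1.sub (aestronglyMeasurable_solution hρ hμ hlim), hk.trans_lt ENNReal.one_lt_top⟩
  refine (hp.sub h1).ae_eq (Eventually.of_forall fun x => ?_)
  simp

theorem tendsto_integral_abs_sub {σ f : ℝ → ℝ} (hσ : IntegrableOn σ (Icc 0 1)) {p : ℕ → ℝ[X]}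
    (hf : MemLp f 2 (densMeasure σ))
    (hL2 : Tendsto (fun k => eLpNorm (fun x => (p k).eval x - f x) 2 (densMeasure σ)) atTop (𝓝 0)) :
    Tendsto (fun k => ∫ x, |(p k).eval x - f x| ∂(densMeasure σ)) atTop (𝓝 0) := by
  have := isFiniteMeasure_densMeasure hσ
  have hm : ∀ k, MemLp (fun x => (p k).eval x - f x) 2 (densMeasure σ) := fun k =>
    (memLp_of_continuousOn hσ (p k).continuous.continuousOn).sub hf
  have h1 : Tendsto (fun k => eLpNorm (fun x => (p k).eval x - f x) 1 (densMeasure σ)) atTop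
      (𝓝 0) := by
    have hC : (densMeasure σ univ) ^ (1 / (1 : ENNReal).toReal - 1 / (2 : ENNReal).toReal) ≠ ⊤ :=
      ENNReal.rpow_ne_top_of_nonneg (by norm_num) (measure_ne_top _ _)
    have h2 := ENNReal.Tendsto.mul_const hL2 (Or.inr hC)
    rw [zero_mul] at h2
    exact tendsto_of_tendsto_of_tendsto_of_le_of_le tendsto_const_nhds h2 (fun k => zero_le)
      fun k => eLpNorm_le_eLpNorm_mul_rpow_measure_univ one_le_two (hm k).1
  have h3 := (ENNReal.tendsto_toReal ENNReal.zero_ne_top).comp h1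
  refine h3.congr fun k => ?_
  simp only [Function.comp, eLpNorm_one_eq_lintegral_enorm]
  rw [← integral_norm_eq_lintegral_enorm (hm k).1]
  rfl

theorem tendsto_moment {σ f : ℝ → ℝ} (hσ : IntegrableOn σ (Icc 0 1))
    (h0 : ∀ x ∈ Ioo (0 : ℝ) 1, 0 ≤ σ x) {p : ℕ → ℝ[X]} (hf : MemLp f 2 (densMeasure σ))
    (hL2 : Tendsto (fun k => eLpNorm (fun x => (p k).eval x - f x) 2 (densMeasure σ)) atTop (𝓝 0)) :
    Tendsto (fun k => moment hσ (p k)) atTop (𝓝 (∫ x, f x ∂(densMeasure σ))) := by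
  have := isFiniteMeasure_densMeasure hσ
  rw [tendsto_iff_norm_sub_tendsto_zero]
  refine squeeze_zero (fun k => norm_nonneg _) (fun k => ?_) (tendsto_integral_abs_sub hσ hf hL2)
  rw [moment_apply, ← integral_densMeasure hσ h0, ← integral_sub
    ((memLp_of_continuousOn hσ (p k).continuous.continuousOn).integrable one_le_two)
    (hf.integrable one_le_two)]
  exact norm_integral_le_integral_norm _

end Solution

/-! ### The solution in L², its uniqueness, and the integral equation -/

section Solution

open Polynomial

variable {ρ μ : ℝ → ℝ} {K : NNReal} {g : ℝ → ℝ} {q : ℕ → ℝ[X]}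

theorem memHyperplane_solution (hρ : IsProbDensity ρ) (hμ : IsSecondaryDensity ρ μ)
    (hf : MemLp (solution ρ μ g) 2 (densMeasure ρ))
    (hL2 : Tendsto (fun k => eLpNorm (fun x => (primPoly hρ hμ (q k)).eval x - solution ρ μ g x) 2
      (densMeasure ρ)) atTop (𝓝 0)) : MemHyperplane ρ (solution ρ μ g) := by
  refine ⟨hf, ?_⟩
  have h := tendsto_moment hρ.integrable hρ.nonneg hf hL2
  simp only [moment_primPoly] at h
  exact (tendsto_nhds_unique h tendsto_const_nhds)

theorem tendsto_eLpNorm_sub_of_bound {σ : ℝ → ℝ} (hσ : IntegrableOn σ (Icc 0 1))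
    (hq : ∀ k, ∀ x ∈ Icc (0 : ℝ) 1, |(q k).eval x - g x| ≤ (1 / 4) ^ k) :
    Tendsto (fun k => eLpNorm (fun x => (q k).eval x - g x) 2 (densMeasure σ)) atTop (𝓝 0) := by
  have h := tendsto_ofReal_pow_mul (rpow_measure_univ_ne_top hσ) 1
  simp only [one_mul] at h
  exact tendsto_of_tendsto_of_tendsto_of_le_of_le tendsto_const_nhds h (fun k => zero_le)
    fun k => eLpNorm_le_of_Icc_bound (hq k)

theorem hasL2Image_solution (hρ : IsProbDensity ρ) (hμ : IsSecondaryDensity ρ μ)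
    (hg : ContinuousOn g (Icc 0 1))
    (hq : ∀ k, ∀ x ∈ Icc (0 : ℝ) 1, |(q k).eval x - g x| ≤ (1 / 4) ^ k)
    (hf : MemLp (solution ρ μ g) 2 (densMeasure ρ))
    (hL2 : Tendsto (fun k => eLpNorm (fun x => (primPoly hρ hμ (q k)).eval x - solution ρ μ g x) 2
      (densMeasure ρ)) atTop (𝓝 0)) : HasL2Image ρ μ (solution ρ μ g) g := by
  refine ⟨hf, memLp_of_continuousOn hμ.integrable hg, fun k => primPoly hρ hμ (q k), hL2, ?_⟩
  simp only [secOp_polynomial hρ.integrable, secPoly_primPoly]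
  exact tendsto_eLpNorm_sub_of_bound hμ.integrable hq

/-- `T_ρ` is injective on `H_ρ`. -/
theorem ae_eq_of_hasL2Image (hρ : IsProbDensity ρ) (hμ : IsSecondaryDensity ρ μ) {f₁ f₂ : ℝ → ℝ}
    (h₁ : MemHyperplane ρ f₁) (h₂ : MemHyperplane ρ f₂)
    (hi₁ : HasL2Image ρ μ f₁ g) (hi₂ : HasL2Image ρ μ f₂ g) : f₁ =ᵐ[densMeasure ρ] f₂ := by
  have := isFiniteMeasure_densMeasure hρ.integrable
  obtain ⟨hf₁, hg, r, hr, hTr⟩ := hi₁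
  obtain ⟨hf₂, -, s, hs, hTs⟩ := hi₂
  simp only [secOp_polynomial hρ.integrable] at hTr hTs
  set L := moment hρ.integrable with hL
  have hmr := tendsto_moment hρ.integrable hρ.nonneg hf₁ hr
  have hms := tendsto_moment hρ.integrable hρ.nonneg hf₂ hs
  rw [h₁.2] at hmr
  rw [h₂.2] at hms
  have hc : ∀ p : ℝ[X], AEStronglyMeasurable (fun x => p.eval x) (densMeasure ρ) := fun p =>
    aestronglyMeasurable_of_continuousOn p.continuous.continuousOn
  have hcμ : ∀ p : ℝ[X], AEStronglyMeasurable (fun x => p.eval x) (densMeasure μ) := fun p =>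
    aestronglyMeasurable_of_continuousOn p.continuous.continuousOn
  -- f₁ and f₂ have mean zero, so the means of their approximations tend to zero.
  have hconst : Tendsto (fun k => eLpNorm (fun _ : ℝ => L (r k - s k)) 2 (densMeasure ρ)) atTop
      (𝓝 0) := by
    have h1 : Tendsto (fun k => ENNReal.ofReal |L (r k - s k)|) atTop (𝓝 0) := by
      have := ENNReal.tendsto_ofReal ((hmr.sub hms).abs)
      simpa only [map_sub, sub_self, abs_zero, ENNReal.ofReal_zero] using this
    have h2 := ENNReal.Tendsto.const_mul h1 (Or.inr (rpow_measure_univ_ne_top hρ.integrable))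
    rw [mul_zero] at h2
    exact tendsto_of_tendsto_of_tendsto_of_le_of_le tendsto_const_nhds h2 (fun k => zero_le)
      fun k => eLpNorm_le_of_Icc_bound fun _ _ => le_rfl
  -- f₁ - f₂ is split into two approximation errors, the centred part of r k - s k, which the
  -- isometry carries to L²(μ), and the mean of r k - s k.
  have hbound : ∀ k, eLpNorm (f₁ - f₂) 2 (densMeasure ρ) ≤
      eLpNorm (fun x => (r k).eval x - f₁ x) 2 (densMeasure ρ) +
      eLpNorm (fun x => (s k).eval x - f₂ x) 2 (densMeasure ρ) +
      (eLpNorm (fun x => (secPoly L (r k)).eval x - g x) 2 (densMeasure μ) +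
      eLpNorm (fun x => (secPoly L (s k)).eval x - g x) 2 (densMeasure μ)) +
      eLpNorm (fun _ : ℝ => L (r k - s k)) 2 (densMeasure ρ) := fun k => by
    have h3 : eLpNorm (fun x => (r k - s k).eval x - L (r k - s k)) 2 (densMeasure ρ) ≤
        eLpNorm (fun x => (secPoly L (r k)).eval x - g x) 2 (densMeasure μ) +
        eLpNorm (fun x => (secPoly L (s k)).eval x - g x) 2 (densMeasure μ) := by
      rw [eLpNorm_sub_moment hρ hμ, ← hL]
      refine le_trans (le_of_eq ?_) (eLpNorm_sub_le ((hcμ _).sub hg.1) ((hcμ _).sub hg.1) one_le_two)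
      congr 1
      funext x
      simp
    have e : f₁ - f₂ = (((fun x => (s k).eval x - f₂ x) - (fun x => (r k).eval x - f₁ x)) +
        (fun x => (r k - s k).eval x - L (r k - s k))) + fun _ => L (r k - s k) := by
      funext x
      simp only [Pi.add_apply, Pi.sub_apply, eval_sub]
      ring
    rw [e]
    have m1 := (hc (r k)).sub hf₁.1
    have m2 := (hc (s k)).sub hf₂.1
    have m3 : AEStronglyMeasurable (fun x => (r k - s k).eval x - L (r k - s k)) (densMeasure ρ) :=
      (hc (r k - s k)).sub aestronglyMeasurable_const
    refine (eLpNorm_add_le ((m2.sub m1).add m3) aestronglyMeasurable_const one_le_two).trans ?_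
    gcongr
    refine (eLpNorm_add_le (m2.sub m1) m3 one_le_two).trans ?_
    gcongr
    rw [add_comm]
    exact eLpNorm_sub_le m2 m1 one_le_two
  have hlim := (((hr.add hs).add (hTr.add hTs)).add hconst)
  simp only [add_zero] at hlim
  have h0 : eLpNorm (f₁ - f₂) 2 (densMeasure ρ) = 0 :=
    le_antisymm (ge_of_tendsto' hlim hbound) zero_le
  rw [eLpNorm_eq_zero_iff (hf₁.1.sub hf₂.1) two_ne_zero] at h0
  filter_upwards [h0] with x hx
  exact sub_eq_zero.1 hx

theorem tendsto_stieltjes_of_tendsto_integral {h : ℝ → ℝ} {u : ℕ → ℝ → ℝ}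
    (hh : IntegrableOn h (Icc 0 1)) (hu : ∀ k, IntegrableOn (u k) (Icc 0 1))
    (hlim : Tendsto (fun k => ∫ t in Icc (0 : ℝ) 1, |u k t - h t|) atTop (𝓝 0)) {z : ℂ}
    (hz : 0 < z.im) : Tendsto (fun k => stieltjes (u k) z) atTop (𝓝 (stieltjes h z)) := by
  rw [tendsto_iff_norm_sub_tendsto_zero]
  have h1 := hlim.div_const z.im
  rw [zero_div] at h1
  refine squeeze_zero (fun k => norm_nonneg _) (fun k => ?_) h1
  rw [← stieltjes_sub (hu k) hh hz]
  exact norm_stieltjes_le ((hu k).sub hh) hz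
    fun t _ => (le_abs_self _).trans (abs_im_le_norm_sub z t)

/-- The Stieltjes transforms of `f ρ` and `g μ` are coupled by that of `ρ`. -/
theorem stieltjes_solution (hρ : IsProbDensity ρ) (hμ : IsSecondaryDensity ρ μ)
    (hg : ContinuousOn g (Icc 0 1))
    (hq : ∀ k, ∀ x ∈ Icc (0 : ℝ) 1, |(q k).eval x - g x| ≤ (1 / 4) ^ k)
    (hf : MemLp (solution ρ μ g) 2 (densMeasure ρ))
    (hL2 : Tendsto (fun k => eLpNorm (fun x => (primPoly hρ hμ (q k)).eval x - solution ρ μ g x) 2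
      (densMeasure ρ)) atTop (𝓝 0)) {z : ℂ} (hz : 0 < z.im) :
    stieltjes (fun t => solution ρ μ g t * ρ t) z =
      stieltjes ρ z * stieltjes (fun t => g t * μ t) z := by
  have := isFiniteMeasure_densMeasure hρ.integrable
  have hfρ := integrableOn_mul_of_integrable_densMeasure hρ.integrable hρ.nonneg
    (hf.integrable one_le_two)
  have h1 : Tendsto (fun k => stieltjes (fun t => (primPoly hρ hμ (q k)).eval t * ρ t) z) atTop
      (𝓝 (stieltjes (fun t => solution ρ μ g t * ρ t) z)) := by
    refine tendsto_stieltjes_of_tendsto_integral hfρ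
      (fun k => integrableOn_eval_mul hρ.integrable _) ?_ hz
    refine (tendsto_integral_abs_sub hρ.integrable hf hL2).congr fun k => ?_
    rw [integral_densMeasure hρ.integrable hρ.nonneg]
    refine integral_congr_ae ?_
    filter_upwards [ae_nonneg_of_Ioo hρ.nonneg] with t ht
    rw [← sub_mul, abs_mul, abs_of_nonneg ht]
  have h2 : Tendsto (fun k => stieltjes (fun t => (q k).eval t * μ t) z) atTop
      (𝓝 (stieltjes (fun t => g t * μ t) z)) := by
    refine tendsto_stieltjes_of_tendsto_integral (integrableOn_continuousOn_mul hμ.integrable hg)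
      (fun k => integrableOn_eval_mul hμ.integrable _) ?_ hz
    have h3 := (tendsto_pow_atTop_nhds_zero_of_lt_one (r := (1 / 4 : ℝ)) (by norm_num)
      (by norm_num)).const_mul (∫ t in Icc (0 : ℝ) 1, μ t)
    rw [mul_zero] at h3
    exact squeeze_zero (fun k => integral_nonneg fun t => abs_nonneg _)
      (fun k => integral_abs_sub_mul_le hμ.nonneg hμ.integrable hg (hq k)) h3
  refine tendsto_nhds_unique h1 ((h2.const_mul (stieltjes ρ z)).congr fun k => ?_)
  rw [stieltjes_primPoly hρ hμ _ hz]

/-- With B the principal value of gμ, the boundary values of S_ρ S_{gμ} have real part HB - π²ρgμ,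
which is therefore the principal value of fρ. Since f - B = gHμ/ρ, subtracting it from fH leaves
(gμ/ρ)(H² + π²ρ²) = g. -/
theorem ae_tendsto_truncSecOp_solution (hρ : IsProbDensity ρ) (hμ : IsSecondaryDensity ρ μ)
    (hK : LipschitzOnWith K ρ (Icc 0 1)) (hg : ContinuousOn g (Icc 0 1))
    (hfρ : IntegrableOn (fun t => solution ρ μ g t * ρ t) (Icc 0 1))
    (hS : ∀ z : ℂ, 0 < z.im → stieltjes (fun t => solution ρ μ g t * ρ t) z =
      stieltjes ρ z * stieltjes (fun t => g t * μ t) z)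
    (hc : ∀ᵐ x ∂(densMeasure ρ), SecOpConverges μ g x) :
    ∀ᵐ x ∂(densMeasure ρ), Tendsto (truncSecOp ρ (solution ρ μ g) x) (𝓝[>] 0) (𝓝 (g x)) := by
  rw [ae_densMeasure_iff hρ.integrable] at hc ⊢
  have hgμ := integrableOn_continuousOn_mul hμ.integrable hg
  filter_upwards [hc, ae_isPoissonLebesguePoint hμ.integrable, ae_isPoissonLebesguePoint hgμ,
    ae_isPoissonLebesguePoint hfρ] with x hcx hL hLg hLf hx hρx
  have hpi := Real.pi_ne_zero
  have hv := tendsto_conjPoissonInt_of_lipschitz hρ.integrable hK hx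
  have hm := hμ.eq_div hρ hx (hL hx) hv (by have := hρx.ne'; positivity)
  have hW := hμ.tendsto_conjPoissonInt hρ hx (hL hx) hv hρx.ne'
  set H := lipHilbert ρ x
  have hTρ := (tendsto_truncHilbert_iff hρ.integrable hx (hρ.isPoissonLebesguePoint hx)).2 hv
  have hTW := (tendsto_truncHilbert_iff hμ.integrable hx (hL hx)).2 hW
  have hTg := tendsto_truncHilbert_mul hμ.integrable hg hTW (hcx hx hρx).tendsto
  have hSρ := tendsto_stieltjes hρ.integrable hx (hρ.isPoissonLebesguePoint hx) hv
  have hSg := tendsto_stieltjes hgμ hx (hLg hx) ((tendsto_truncHilbert_iff hgμ hx (hLg hx)).1 hTg)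
  set B := g x * (x - firstMoment ρ - H * μ x / ρ x) - secOp μ g x with hB
  have hre : Tendsto (conjPoissonInt (fun t => solution ρ μ g t * ρ t) x) (𝓝[>] 0)
      (𝓝 (H * B - Real.pi * ρ x * (Real.pi * (g x * μ x)))) := by
    have h1 := (Complex.continuous_re.tendsto _).comp (hSρ.mul hSg)
    refine (h1.congr' ?_).trans_eq ?_
    · filter_upwards [self_mem_nhdsWithin] with ε (hε : 0 < ε)
      simp only [Function.comp]
      rw [← hS _ (by simpa using hε), stieltjes_add_mul_I hfρ hε]
      simp
    · congr 1
      simp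
  have hTf := (tendsto_truncHilbert_iff hfρ hx (hLf hx)).2 hre
  have h := (hTρ.const_mul (solution ρ μ g x)).sub hTf
  have e : solution ρ μ g x * H - (H * B - Real.pi * ρ x * (Real.pi * (g x * μ x))) = g x := by
    rw [hB, solution, hm]
    have := hρx.ne'
    have hD : H ^ 2 + (Real.pi * ρ x) ^ 2 ≠ 0 := by positivity
    field_simp
    ring
  rw [e] at h
  refine h.congr' ?_
  filter_upwards [self_mem_nhdsWithin] with ε (hε : 0 < ε)
  rw [truncSecOp_eq hρ.integrable hfρ hε]

end Solution

end SecondaryMeasure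

end

/-! ### Assembly -/

theorem mainTheorem6 (ρ μ : ℝ → ℝ) (hρ : SecondaryMeasure.IsProbDensity ρ)
    (hμ : SecondaryMeasure.IsSecondaryDensity ρ μ) :
    -- the density `μ` is determined up to a null set; no point of continuity of `μ` is exceptional
    ∃ N : Set ℝ, volume N = 0 ∧ (∀ x ∈ Ioo (0 : ℝ) 1, ContinuousAt μ x → x ∉ N) ∧
      -- the reducer of `μ`
      (∀ x ∈ Ioo (0 : ℝ) 1, x ∉ N → ρ x ≠ 0 → ∀ φ : ℝ, SecondaryMeasure.HasReducerAt ρ x φ →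
        SecondaryMeasure.HasReducerAt μ x
          (2 * (x - SecondaryMeasure.firstMoment ρ) - φ * μ x / ρ x)) ∧
      ∀ K : NNReal, LipschitzOnWith K ρ (Icc 0 1) →
        (∀ x ∈ Ioo (0 : ℝ) 1,
          SecondaryMeasure.HasReducerAt ρ x (SecondaryMeasure.reducer ρ x)) ∧
        ∀ g : ℝ → ℝ, ContinuousOn g (Icc 0 1) →
          -- the simplification of the expression of the solution
          (∀ x ∈ Ioo (0 : ℝ) 1, x ∉ N → ρ x ≠ 0 → SecondaryMeasure.SecOpConverges μ g x →
            SecondaryMeasure.SecOpConverges ρ (fun t => μ t / ρ t * g t) x ∧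
            (IntegrableOn (SecondaryMeasure.secKernel μ g x) (Icc 0 1) →
              IntegrableOn (SecondaryMeasure.secKernel ρ (fun t => μ t / ρ t * g t) x)
                (Icc 0 1)) ∧
            SecondaryMeasure.reducer ρ x * (μ x / ρ x) * g x -
                SecondaryMeasure.secOp ρ (fun t => μ t / ρ t * g t) x =
              (x - SecondaryMeasure.firstMoment ρ) * g x - SecondaryMeasure.secOp μ g x) ∧
          -- the simplified expression is the solution of `T_ρ(f) = g` in the hyperplane `H_ρ`
          ((∀ᵐ x ∂(SecondaryMeasure.densMeasure ρ), SecondaryMeasure.SecOpConverges μ g x) →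
            ∀ f : ℝ → ℝ,
              (∀ x, f x =
                (x - SecondaryMeasure.firstMoment ρ) * g x - SecondaryMeasure.secOp μ g x) →
              SecondaryMeasure.MemHyperplane ρ f ∧
              SecondaryMeasure.HasL2Image ρ μ f g ∧
              (∀ᵐ x ∂(SecondaryMeasure.densMeasure ρ),
                SecondaryMeasure.SecOpConverges ρ f x ∧ SecondaryMeasure.secOp ρ f x = g x) ∧
              (∀ f₁ : ℝ → ℝ, SecondaryMeasure.MemHyperplane ρ f₁ →
                SecondaryMeasure.HasL2Image ρ μ f₁ g →
                f₁ =ᵐ[SecondaryMeasure.densMeasure ρ] f)) := by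
  open SecondaryMeasure in
  -- The exceptional set depends on μ alone, so a single N serves every φ and g.
  refine ⟨{x | x ∈ Ioo (0 : ℝ) 1 ∧ ¬ IsPoissonLebesguePoint μ x}, ?_, ?_, ?_, ?_⟩
  · refine measure_mono_null (fun x hx => ?_) (ae_iff.1 (ae_isPoissonLebesguePoint hμ.integrable))
    exact fun h => hx.2 (h hx.1)
  · exact fun x _ hc hN => hN.2 (isPoissonLebesguePoint_of_continuousAt hμ.integrable hc)
  · intro x hx hN hne φ hφ
    exact hμ.hasReducerAt hρ hx (not_not.1 fun h => hN ⟨hx, h⟩) hφ hne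
  · intro K hK
    have hred : ∀ x ∈ Ioo (0 : ℝ) 1, HasReducerAt ρ x (2 * lipHilbert ρ x) := fun x hx => by
      rw [hasReducerAt_iff, mul_div_cancel_left₀ _ two_ne_zero]
      exact tendsto_conjPoissonInt_of_lipschitz hρ.integrable hK hx
    refine ⟨fun x hx => by rw [(hred x hx).reducer_eq]; exact hred x hx, fun g hg => ⟨?_, ?_⟩⟩
    · intro x hx hN hne hc
      have hL : IsPoissonLebesguePoint μ x := not_not.1 fun h => hN ⟨hx, h⟩
      have h := hμ.secOp_div_mul hρ hK hg hx hL hne hc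
      refine ⟨⟨_, h⟩, hμ.integrableOn_secKernel hρ hK hx hL hne, ?_⟩
      rw [secOp, h.limUnder_eq, (hred x hx).reducer_eq]
      ring
    · intro hc f hf
      obtain rfl : f = solution ρ μ g := funext hf
      -- Weierstrass approximation at the rate 4^(-k) demanded by `ae_tendsto_boundarySize`.
      choose q hq using fun k : ℕ => exists_polynomial_near_of_continuousOn 0 1 g hg ((1 / 4) ^ k)
        (by positivity)
      have hq' := fun k x hx => (hq k x hx).le
      have hlim := ae_tendsto_primPoly hρ hμ hK hg hq' hc
      have hL2 := tendsto_eLpNorm_sub_solution hρ hμ hq' hlim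
      have hfm := memLp_solution hρ hμ hlim hL2
      have hH := memHyperplane_solution hρ hμ hfm hL2
      have hI := hasL2Image_solution hρ hμ hg hq' hfm hL2
      have := isFiniteMeasure_densMeasure hρ.integrable
      refine ⟨hH, hI, ?_, fun f₁ h₁ hi₁ => ae_eq_of_hasL2Image hρ hμ h₁ hH hi₁ hI⟩
      filter_upwards [ae_tendsto_truncSecOp_solution hρ hμ hK hg
        (integrableOn_mul_of_integrable_densMeasure hρ.integrable hρ.nonneg
          (hfm.integrable one_le_two))
        (fun z hz => stieltjes_solution hρ hμ hg hq' hfm hL2 hz) hc] with x hx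
      exact ⟨⟨_, hx⟩, hx.limUnder_eq⟩
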